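/- Let $\theta:\{1,2,3,\dots\}\to\mathbb{R}\cup\{\infty\}$ satisfy $\theta(1)\ge 2$ and $\theta(n)\ge P^+(n)$ for all $n\ge 2$, where $P^+(n)$ denotes the largest prime factor of $n$. Let $\mathcal{B}$ be the set of positive integers consisting of $n=1$ and all $n\ge 2$ with prime factorization $n=p_1^{\alpha_1}\cdots p_k^{\alpha_k}$, $p_1<p_2<\dots<p_k$, such that $$p_{j+1}\le\theta\bigl(p_1^{\alpha_1}\cdots p_j^{\alpha_j}\bigr)\qquad(0\le j<k),$$ where the empty product ($j=0$) is $1$. Let $\chi$ be the characteristic function of $\mathcal{B}$, let $B(x)$ be the number of $n\le x$ in $\mathcal{B}$, and let $$L=\sum_{n\ge 1}\frac{\chi(n)}{n}\prod_{p\le\theta(n)}\Bigl(1-\frac1p\Bigr),$$ where $p$ runs over primes and the product over all primes (the case $\theta(n)=\infty$) is $0$. Put $\log\infty=\infty$. For a positive function $g$, write $\log\theta(n)\asymp g(n)$ if there are constants $c,C>0$ such that $c\,g(n)\le\log\theta(n)\le C\,g(n)$ for all sufficiently large $n$. (i) If $\log\theta(n)\asymp n^a$ for some constant $a>0$, then $0<L<1$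 and, for $x\ge 2$, $$B(x)=(1-L)\,x\left(1+O\left(\frac{1}{\log x}\right)\right).$$ (ii) If $\log\theta(n)\asymp(\log 2n)^a$ for some constant $a>1$, then $0<L<1$ and, for $x\ge 2$, $$B(x)=(1-L)\,x\left(1+O\left(\frac{1}{(\log x)^{1-1/a}}\right)\right).$$ The implied constants may depend on $\theta$ (and hence on $a$). -/

import Mathlib

namespace SieveProblem

/-- The largest prime factor `P⁺(n)` of `n ≥ 2`, with `P⁺(1) = 1`. -/
def largestPrimeFactor (n : ℕ) : ℕ := max 1 (n.primeFactors.sup id)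

/-- The standing assumption on `θ : ℕ → ℝ ∪ {∞}`: `θ(1) ≥ 2`, and `θ(n) ≥ P⁺(n)` for `n ≥ 2`. The
value at `0` is never used. -/
def Admissible (θ : ℕ → WithTop ℝ) : Prop :=
  ((2 : ℝ) : WithTop ℝ) ≤ θ 1 ∧
    ∀ n : ℕ, 2 ≤ n → (((largestPrimeFactor n : ℕ) : ℝ) : WithTop ℝ) ≤ θ n

/-- For `n = p₁^α₁ ⋯ pₖ^αₖ` with `p₁ < ⋯ < pₖ` and `p = p_{j+1}`, this is `p₁^α₁ ⋯ pⱼ^αⱼ`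
(equal to `1` when `j = 0`). -/
def partBelow (n p : ℕ) : ℕ :=
  ∏ q ∈ n.primeFactors with q < p, q ^ n.factorization q

/-- The set `B_θ` of positive integers `n = p₁^α₁ ⋯ pₖ^αₖ`, `p₁ < ⋯ < pₖ`, such that
`p_{j+1} ≤ θ(p₁^α₁ ⋯ pⱼ^αⱼ)` for `0 ≤ j < k`. It contains `n = 1`. -/
def sieveSet (θ : ℕ → WithTop ℝ) : Set ℕ :=
  {n | 0 < n ∧ ∀ p ∈ n.primeFactors, ((p : ℝ) : WithTop ℝ) ≤ θ (partBelow n p)}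

/-- `B(x)`, the number of positive integers `n ≤ x` in `B_θ`. -/
noncomputable def countB (θ : ℕ → WithTop ℝ) (x : ℝ) : ℕ :=
  {n : ℕ | n ∈ sieveSet θ ∧ (n : ℝ) ≤ x}.ncard

/-- `∏_{p ≤ y} (1 - 1/p)` for `y ∈ ℝ ∪ {∞}`. For real `y` the product is finite; for `y = ∞` it runs
over all primes, and its partial products converge to `0`. -/
noncomputable def eulerProduct (y : WithTop ℝ) : ℝ :=
  ∏' p : {p : ℕ // p.Prime ∧ ((p : ℝ) : WithTop ℝ) ≤ y}, (1 - 1 / ((p : ℕ) : ℝ))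

/-- `L = ∑_{n ≥ 1} (χ(n) / n) ∏_{p ≤ θ(n)} (1 - 1/p)`, where `χ` is the characteristic function of
`B_θ`. -/
noncomputable def sieveL (θ : ℕ → WithTop ℝ) : ℝ :=
  ∑' n : ℕ, (sieveSet θ).indicator (fun n => 1 / (n : ℝ) * eulerProduct (θ n)) n

/-- The logarithm on `ℝ ∪ {∞}`, with `log ∞ = ∞`. -/
noncomputable def extLog (y : WithTop ℝ) : WithTop ℝ := WithTop.map Real.log y

/-- `f(n) ≍ g(n)`: `f(n) ≪ g(n)` and `g(n) ≪ f(n)`, for an extended real valued `f` and a positive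
real valued `g`. -/
def Asymp (f : ℕ → WithTop ℝ) (g : ℕ → ℝ) : Prop :=
  ∃ c C : ℝ, 0 < c ∧ 0 < C ∧ ∀ᶠ n : ℕ in Filter.atTop,
    ((c * g n : ℝ) : WithTop ℝ) ≤ f n ∧ f n ≤ ((C * g n : ℝ) : WithTop ℝ)

end SieveProblem

/-!
Let `Φ(x, y)` be the number of integers `1 ≤ n ≤ x` all of whose prime factors exceed `y`, and
`W(y) = ∏_{p ≤ y} (1 - 1/p)`. Every positive integer `n` is uniquely `n = m r` with `m` in the sieve
set and all primes of `r` larger than `θ(m)`: cut `n` at the first prime that violates the defining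
condition. Counting the `n ≤ x` outside the sieve set by `m` (`card_notMem_sieveSet`) gives
`B(x) = ⌊x⌋ - ∑_{m ∈ B} (Φ(x/m, θ(m)) - 1)`, where only the `m` with `θ(m) < x/m` contribute.

The second ingredient is the fundamental lemma
`Φ(x, y) = x W(y) (1 + O((log y / log x)³))` for `2 ≤ y ≤ x` (`exists_abs_roughCount_sub_le`).
It is proved by passing from `y` to `y^{1/s}` for a large constant `s`: in Legendre's identity over
the primes in `(y^{1/s}, y]`, the divisors up to `√x` are handled by induction, and the others by
Rankin's trick together with the upper bound `Φ(x, y) ≪ x W(y)`. At each step the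
inherited error is multiplied by `O(1/s)`, since `W(y^{1/s}) / W(y) ≪ s`, so the recursion
converges uniformly in `y`. This rests on Mertens' bounds `W(y) ≍ 1 / log y` and on
Chebyshev's bound `ψ(x) ≪ x`.

Writing `g(m)` for the order of growth of `log θ(m)`, the `m` that contribute satisfy
`g(m) ≪ log x` and `log (x/m) ≫ log x`, and replacing `Φ(x/m, θ(m)) - 1` by `(x/m) W(θ(m))` costs
`O(x (log x)⁻² ∑ g(m)/m)`. The sum of `χ(m) W(θ(m)) / m` over the remaining `m` is at most
a constant times the sum of `1 / (m g(m))` over `g(m) ≫ log x`. Both are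
`O(x (log x)^{-(1-β)})` after multiplying the latter by `x`, with `β = 0` for
`g(m) = m^a` and `β = 1/a` for `g(m) = (log 2m)^a` (`RegularGrowth`).

Finally `L > 0` because large powers of `2` contribute, and `L < 1` because, for a large power `q`
of `2`, asymptotically at least half of the multiples of `q` lie in the sieve set
(`exists_le_countB`).
-/

namespace SieveProblem

/-! ### Euler products over the primes up to a real bound -/

/-- The primes `p ≤ y`. -/
noncomputable def primesUpTo (y : ℝ) : Finset ℕ := {p ∈ Finset.Icc 1 ⌊y⌋₊ | p.Prime}

lemma mem_primesUpTo {y : ℝ} {p : ℕ} : p ∈ primesUpTo y ↔ p.Prime ∧ (p : ℝ) ≤ y := by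
  simp only [primesUpTo, Finset.mem_filter, Finset.mem_Icc]
  constructor
  · rintro ⟨⟨h1, h2⟩, hp⟩
    exact ⟨hp, (Nat.le_floor_iff' hp.ne_zero).1 h2⟩
  · rintro ⟨hp, h⟩
    exact ⟨⟨hp.one_le, (Nat.le_floor_iff' hp.ne_zero).2 h⟩, hp⟩

lemma primesUpTo_mono {y z : ℝ} (h : y ≤ z) : primesUpTo y ⊆ primesUpTo z := by
  intro p hp
  rw [mem_primesUpTo] at hp ⊢
  exact ⟨hp.1, hp.2.trans h⟩

/-- The Euler product `W(y) = ∏_{p ≤ y} (1 - 1/p)`. -/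
noncomputable def eulerW (y : ℝ) : ℝ := ∏ p ∈ primesUpTo y, (1 - 1 / (p : ℝ))

lemma one_div_prime_le_half {p : ℕ} (hp : p.Prime) : 1 / (p : ℝ) ≤ 1 / 2 :=
  one_div_le_one_div_of_le two_pos (by exact_mod_cast hp.two_le)

lemma one_sub_one_div_prime_pos {p : ℕ} (hp : p.Prime) : 0 < 1 - 1 / (p : ℝ) := by
  have := one_div_prime_le_half hp
  linarith

lemma eulerW_pos (y : ℝ) : 0 < eulerW y :=
  Finset.prod_pos fun _ hp => one_sub_one_div_prime_pos (mem_primesUpTo.1 hp).1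

lemma eulerW_eq_mul {y z : ℝ} (h : y ≤ z) :
    eulerW z = eulerW y * ∏ p ∈ primesUpTo z \ primesUpTo y, (1 - 1 / (p : ℝ)) := by
  rw [eulerW, eulerW, mul_comm, Finset.prod_sdiff (primesUpTo_mono h)]

lemma eulerW_of_lt_two {y : ℝ} (h : y < 2) : eulerW y = 1 := by
  refine Finset.prod_eq_one fun p hp => ?_
  rw [mem_primesUpTo] at hp
  have : (2 : ℝ) ≤ p := by exact_mod_cast hp.1.two_le
  linarith [hp.2]

/-- The completely multiplicative function `n ↦ n⁻ˢ`. -/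
noncomputable def rpowNegHom (s : ℝ) : ℕ →* ℝ where
  toFun n := (n : ℝ) ^ (-s)
  map_one' := by simp
  map_mul' m n := by
    rw [Nat.cast_mul, Real.mul_rpow (Nat.cast_nonneg m) (Nat.cast_nonneg n)]

lemma rpowNegHom_apply (s : ℝ) (n : ℕ) : rpowNegHom s n = (n : ℝ) ^ (-s) := rfl

lemma norm_rpowNegHom_prime_lt_one {s : ℝ} (hs : 0 < s) {p : ℕ} (hp : p.Prime) :
    ‖rpowNegHom s p‖ < 1 := by
  rw [rpowNegHom_apply, Real.norm_of_nonneg (by positivity)]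
  exact Real.rpow_lt_one_of_one_lt_of_neg (by exact_mod_cast hp.one_lt) (by linarith)

/-- The reciprocals of integers composed of primes from `S` sum to at most the Euler product
over `S`. -/
lemma sum_one_div_le_prod_inv {S T : Finset ℕ} (hS : ∀ p ∈ S, p.Prime)
    (hT : ∀ n ∈ T, n ∈ Nat.factoredNumbers S) :
    ∑ n ∈ T, 1 / (n : ℝ) ≤ (∏ p ∈ S, (1 - 1 / (p : ℝ)))⁻¹ := by
  obtain ⟨h1, h2⟩ := EulerProduct.summable_and_hasSum_factoredNumbers_prod_filter_prime_geometric
    (f := rpowNegHom 1) (fun hp => norm_rpowNegHom_prime_lt_one one_pos hp) S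
  rw [Finset.filter_true_of_mem hS] at h2
  have h3 : ∑ n ∈ T.attach, rpowNegHom 1 n ≤ ∏ p ∈ S, (1 - rpowNegHom 1 p)⁻¹ := by
    have := sum_le_hasSum (T.attach.map ⟨fun n : T => (⟨n.1, hT n.1 n.2⟩ : Nat.factoredNumbers S),
      fun a b hab => Subtype.ext (by simpa using hab)⟩)
      (fun i _ => by rw [rpowNegHom_apply]; positivity) h2
    rw [Finset.sum_map] at this
    exact this
  rw [Finset.sum_attach T (fun n => rpowNegHom 1 n)] at h3
  simpa [rpowNegHom_apply, Real.rpow_neg_one] using h3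

/-- Mertens' upper bound: `W(y) log y ≤ 1`. -/
lemma eulerW_mul_log_le_one {y : ℝ} (hy : 1 ≤ y) : eulerW y * Real.log y ≤ 1 := by
  have h1 : ∑ n ∈ Finset.Icc 1 ⌊y⌋₊, 1 / (n : ℝ) ≤ (eulerW y)⁻¹ := by
    refine sum_one_div_le_prod_inv (fun p hp => (mem_primesUpTo.1 hp).1) fun n hn => ?_
    rw [Finset.mem_Icc] at hn
    rw [Nat.mem_factoredNumbers]
    refine ⟨by omega, fun p hp => ?_⟩
    have hp' := Nat.prime_of_mem_primeFactorsList hp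
    refine mem_primesUpTo.2 ⟨hp', (Nat.le_floor_iff' hp'.ne_zero).1 ?_⟩
    exact (Nat.le_of_dvd (by omega) (Nat.dvd_of_mem_primeFactorsList hp)).trans hn.2
  have h2 := log_le_harmonic_floor y (by linarith)
  have h3 : ((harmonic ⌊y⌋₊ : ℚ) : ℝ) = ∑ n ∈ Finset.Icc 1 ⌊y⌋₊, 1 / (n : ℝ) := by
    rw [harmonic_eq_sum_Icc]
    simp
  rw [h3] at h2
  have h4 := mul_le_mul_of_nonneg_left (h2.trans h1) (eulerW_pos y).le
  rwa [mul_inv_cancel₀ (eulerW_pos y).ne'] at h4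

/-- `Σ_{p ≤ n} (log p)/p ≤ log n + O(1)`, obtained by comparing `log n!` with
`Σ_{d ≤ n} Λ(d) ⌊n/d⌋`. -/
lemma sum_log_div_prime_le {n : ℕ} (hn : 1 ≤ n) :
    ∑ p ∈ primesUpTo n, Real.log p / p ≤ Real.log n + (Real.log 4 + 4) := by
  have hn0 : (0 : ℝ) < n := by exact_mod_cast hn
  have h1 : ∑ m ∈ Finset.Ioc 0 n, Real.log m
      = ∑ d ∈ Finset.Ioc 0 n, ArithmeticFunction.vonMangoldt d * ((n / d : ℕ) : ℝ) := by
    have : ∀ m ∈ Finset.Ioc 0 n, Real.log m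
        = ∑ d ∈ Finset.Ioc 0 n, if d ∣ m then ArithmeticFunction.vonMangoldt d else 0 := by
      intro m hm
      rw [Finset.mem_Ioc] at hm
      rw [← ArithmeticFunction.vonMangoldt_sum, ← Finset.sum_filter]
      refine Finset.sum_congr ?_ fun _ _ => rfl
      ext d
      simp only [Nat.mem_divisors, Finset.mem_filter, Finset.mem_Ioc]
      constructor
      · rintro ⟨h, _⟩
        exact ⟨⟨Nat.pos_of_dvd_of_pos h hm.1, (Nat.le_of_dvd hm.1 h).trans hm.2⟩, h⟩
      · rintro ⟨_, h⟩
        exact ⟨h, by omega⟩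
    rw [Finset.sum_congr rfl this, Finset.sum_comm]
    refine Finset.sum_congr rfl fun d _ => ?_
    rw [← Finset.sum_filter, Finset.sum_const, Nat.Ioc_filter_dvd_card_eq_div, nsmul_eq_mul,
      mul_comm]
  have h2 : ∑ m ∈ Finset.Ioc 0 n, Real.log m ≤ n * Real.log n := by
    calc ∑ m ∈ Finset.Ioc 0 n, Real.log m ≤ ∑ m ∈ Finset.Ioc 0 n, Real.log n := by
          refine Finset.sum_le_sum fun m hm => ?_
          rw [Finset.mem_Ioc] at hm
          exact Real.log_le_log (by exact_mod_cast hm.1) (by exact_mod_cast hm.2)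
      _ = _ := by simp
  have h3 : (n : ℝ) * ∑ d ∈ Finset.Ioc 0 n, ArithmeticFunction.vonMangoldt d / d
      - Chebyshev.psi n ≤ ∑ d ∈ Finset.Ioc 0 n,
        ArithmeticFunction.vonMangoldt d * ((n / d : ℕ) : ℝ) := by
    rw [Chebyshev.psi, Nat.floor_natCast, Finset.mul_sum, ← Finset.sum_sub_distrib]
    refine Finset.sum_le_sum fun d hd => ?_
    have h0 := ArithmeticFunction.vonMangoldt_nonneg (n := d)
    have h4 : (n : ℝ) / d - 1 ≤ ((n / d : ℕ) : ℝ) := by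
      rw [← Nat.floor_div_eq_div (K := ℝ)]
      exact (Nat.sub_one_lt_floor _).le
    calc (n : ℝ) * (ArithmeticFunction.vonMangoldt d / d) - ArithmeticFunction.vonMangoldt d
        = ArithmeticFunction.vonMangoldt d * ((n : ℝ) / d - 1) := by ring
      _ ≤ _ := mul_le_mul_of_nonneg_left h4 h0
  have h5 := Chebyshev.psi_le_const_mul_self hn0.le
  have h6 : ∑ p ∈ primesUpTo n, Real.log p / p
      ≤ ∑ d ∈ Finset.Ioc 0 n, ArithmeticFunction.vonMangoldt d / d := by
    have : ∀ p ∈ primesUpTo n, Real.log p / p = ArithmeticFunction.vonMangoldt p / p := by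
      intro p hp
      rw [ArithmeticFunction.vonMangoldt_apply_prime (mem_primesUpTo.1 hp).1]
    rw [Finset.sum_congr rfl this]
    refine Finset.sum_le_sum_of_subset_of_nonneg (fun p hp => ?_) fun d _ _ =>
      div_nonneg ArithmeticFunction.vonMangoldt_nonneg (by positivity)
    rw [mem_primesUpTo] at hp
    exact Finset.mem_Ioc.2 ⟨hp.1.pos, by exact_mod_cast hp.2⟩
  refine h6.trans (le_of_mul_le_mul_left ?_ hn0)
  rw [h1] at h2
  linarith

/-- `Σ_{p ≤ x} (log p)/p ≪ log x`. -/
lemma exists_sum_log_div_prime_le :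
    ∃ C : ℝ, 0 < C ∧ ∀ x : ℝ, 2 ≤ x →
      ∑ p ∈ primesUpTo x, Real.log p / p ≤ C * Real.log x := by
  have hl2 : 0 < Real.log 2 := Real.log_pos one_lt_two
  have hl4 : 0 < Real.log 4 := Real.log_pos (by norm_num)
  refine ⟨1 + (Real.log 4 + 4) / Real.log 2, by positivity, fun x hx => ?_⟩
  have hf : 1 ≤ ⌊x⌋₊ := Nat.one_le_floor_iff _ |>.2 (by linarith)
  have h1 : primesUpTo x = primesUpTo (⌊x⌋₊ : ℕ) := by simp [primesUpTo]
  have h2 := sum_log_div_prime_le hf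
  have h3 : Real.log (⌊x⌋₊ : ℕ) ≤ Real.log x :=
    Real.log_le_log (by exact_mod_cast hf) (Nat.floor_le (by linarith))
  have h4 : Real.log 2 ≤ Real.log x := Real.log_le_log two_pos hx
  rw [h1]
  have h5 : Real.log 4 + 4 ≤ (Real.log 4 + 4) / Real.log 2 * Real.log x := by
    rw [div_mul_eq_mul_div, le_div_iff₀ hl2]
    exact mul_le_mul_of_nonneg_left h4 (by positivity)
  linarith

/-- A convexity inequality for `t ↦ t^{-σ}`, used to bound sums by telescoping. -/
lemma mul_sub_le_rpow_neg_sub {σ A B : ℝ} (hσ : 0 < σ) (hA : 0 < A) (hB : 0 < B) :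
    σ * (B ^ (-(1 + σ)) * (B - A)) ≤ A ^ (-σ) - B ^ (-σ) := by
  have h1 : A ^ (-σ) = B ^ (-σ) * Real.exp (σ * Real.log (B / A)) := by
    rw [Real.rpow_def_of_pos hA, Real.rpow_def_of_pos hB, ← Real.exp_add,
      Real.log_div hB.ne' hA.ne']
    congr 1
    ring
  have h2 := Real.add_one_le_exp (σ * Real.log (B / A))
  have h3 := Real.one_sub_inv_le_log_of_pos (div_pos hB hA)
  have h4 : B ^ (-(1 + σ)) * (B - A) = B ^ (-σ) * (1 - (B / A)⁻¹) := by
    rw [show -(1 + σ) = -σ - 1 by ring, Real.rpow_sub_one hB.ne', inv_div]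
    field_simp
  have h5 : 0 < B ^ (-σ) := Real.rpow_pos_of_pos hB _
  rw [h4, h1]
  nlinarith [mul_le_mul_of_nonneg_left h3 hσ.le]

lemma sum_rpow_neg_le {σ : ℝ} (hσ : 0 < σ) (N : ℕ) :
    ∑ n ∈ Finset.Icc 1 N, (n : ℝ) ^ (-(1 + σ)) ≤ 1 + 1 / σ := by
  have key : ∀ N : ℕ, ∑ n ∈ Finset.Icc 1 (N + 1), (n : ℝ) ^ (-(1 + σ))
      ≤ 1 + 1 / σ * (1 - ((N + 1 : ℕ) : ℝ) ^ (-σ)) := by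
    intro N
    induction N with
    | zero => simp
    | succ N ih =>
      rw [Finset.sum_Icc_succ_top (by omega)]
      have h := mul_sub_le_rpow_neg_sub hσ (A := ((N + 1 : ℕ) : ℝ)) (B := ((N + 1 + 1 : ℕ) : ℝ))
        (by positivity) (by positivity)
      have h' : ((N + 1 + 1 : ℕ) : ℝ) - ((N + 1 : ℕ) : ℝ) = 1 := by push_cast; ring
      rw [h', mul_one] at h
      have h2 : ((N + 1 + 1 : ℕ) : ℝ) ^ (-(1 + σ))
          ≤ 1 / σ * (((N + 1 : ℕ) : ℝ) ^ (-σ) - ((N + 1 + 1 : ℕ) : ℝ) ^ (-σ)) := by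
        rw [one_div, le_inv_mul_iff₀ hσ]
        exact h
      linarith
  refine (Finset.sum_le_sum_of_subset_of_nonneg (Finset.Icc_subset_Icc_right (Nat.le_succ N))
    fun n _ _ => by positivity).trans ((key N).trans ?_)
  have : 0 ≤ 1 / σ * ((N + 1 : ℕ) : ℝ) ^ (-σ) := by positivity
  linarith

/-- The Euler product of `ζ(1 + σ)` over the primes up to `x` is at most `1 + 1/σ`. -/
lemma prod_inv_one_sub_rpow_le {σ : ℝ} (hσ : 0 < σ) (x : ℝ) :
    ∏ p ∈ primesUpTo x, (1 - (p : ℝ) ^ (-(1 + σ)))⁻¹ ≤ 1 + 1 / σ := by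
  obtain ⟨-, h2⟩ := EulerProduct.summable_and_hasSum_factoredNumbers_prod_filter_prime_geometric
    (f := rpowNegHom (1 + σ)) (fun hp => norm_rpowNegHom_prime_lt_one (by linarith) hp)
    (primesUpTo x)
  rw [Finset.filter_true_of_mem (fun p hp => (mem_primesUpTo.1 hp).1)] at h2
  refine hasSum_le_of_sum_le h2 fun T => ?_
  calc ∑ m ∈ T, rpowNegHom (1 + σ) m
      = ∑ n ∈ T.map (Function.Embedding.subtype _), rpowNegHom (1 + σ) n := by
        rw [Finset.sum_map]; rfl
    _ ≤ ∑ n ∈ Finset.Icc 1 ((T.map (Function.Embedding.subtype _)).sup id),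
          rpowNegHom (1 + σ) n := by
        refine Finset.sum_le_sum_of_subset_of_nonneg (fun n hn => ?_) fun n _ _ => by
          rw [rpowNegHom_apply]; positivity
        have h3 : n ≠ 0 := by
          obtain ⟨m, -, rfl⟩ := Finset.mem_map.1 hn
          exact Nat.ne_zero_of_mem_factoredNumbers m.2
        exact Finset.mem_Icc.2 ⟨Nat.one_le_iff_ne_zero.2 h3, Finset.le_sup (f := id) hn⟩
    _ ≤ 1 + 1 / σ := sum_rpow_neg_le hσ _

/-- Mertens' lower bound: `W(x) ≫ 1 / log x`. The product is compared with that of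
`ζ(1 + 1/log x)`. -/
lemma exists_le_eulerW_mul_log :
    ∃ c : ℝ, 0 < c ∧ ∀ x : ℝ, 2 ≤ x → c ≤ eulerW x * Real.log x := by
  obtain ⟨C, hC, hC'⟩ := exists_sum_log_div_prime_le
  have hl2 : 0 < Real.log 2 := Real.log_pos one_lt_two
  refine ⟨((1 / Real.log 2 + 1) * Real.exp (2 * C))⁻¹, by positivity, fun x hx => ?_⟩
  have hl : 0 < Real.log x := Real.log_pos (by linarith)
  have hl' : Real.log 2 ≤ Real.log x := Real.log_le_log two_pos hx
  set σ := 1 / Real.log x with hσ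
  have hσ0 : 0 < σ := by positivity
  have h1 : (eulerW x)⁻¹ ≤ (∏ p ∈ primesUpTo x, (1 - (p : ℝ) ^ (-(1 + σ)))⁻¹)
      * ∏ p ∈ primesUpTo x, Real.exp (2 * σ * (Real.log p / p)) := by
    rw [eulerW, ← Finset.prod_inv_distrib, ← Finset.prod_mul_distrib]
    refine Finset.prod_le_prod (fun p hp => ?_) fun p hp => ?_
    · exact inv_nonneg.2 (one_sub_one_div_prime_pos (mem_primesUpTo.1 hp).1).le
    · have hp' := (mem_primesUpTo.1 hp).1
      have hp0 : (0 : ℝ) < p := by exact_mod_cast hp'.pos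
      have h2 := one_sub_one_div_prime_pos hp'
      have h3 := one_div_prime_le_half hp'
      have h4 : (p : ℝ) ^ (-(1 + σ)) = 1 / p * Real.exp (-(σ * Real.log p)) := by
        rw [Real.rpow_def_of_pos hp0, show Real.log p * -(1 + σ)
          = -Real.log p + -(σ * Real.log p) by ring, Real.exp_add, Real.exp_neg,
          Real.exp_log hp0, one_div]
      have h5 : 1 - σ * Real.log p ≤ Real.exp (-(σ * Real.log p)) := by
        linarith [Real.add_one_le_exp (-(σ * Real.log p))]
      have h5' : Real.exp (-(σ * Real.log p)) ≤ 1 := by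
        rw [Real.exp_le_one_iff, neg_nonpos]
        exact mul_nonneg hσ0.le (Real.log_nonneg (by exact_mod_cast hp'.one_le))
      have h6 : 0 < 1 / (p : ℝ) := by positivity
      have h7 : 0 < 1 - (p : ℝ) ^ (-(1 + σ)) := by
        rw [h4]; nlinarith
      rw [inv_mul_eq_div, le_div_iff₀ h7, inv_mul_le_iff₀ h2]
      have h8 := Real.add_one_le_exp (2 * σ * (Real.log p / p))
      have h9 : 0 ≤ σ * (Real.log p / p) := mul_nonneg hσ0.le
        (div_nonneg (Real.log_nonneg (by exact_mod_cast hp'.one_le)) hp0.le)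
      refine le_trans ?_ (mul_le_mul_of_nonneg_left h8 h2.le)
      have h10 : 1 / (p : ℝ) * (1 - σ * Real.log p) ≤ (p : ℝ) ^ (-(1 + σ)) := by
        rw [h4]; exact mul_le_mul_of_nonneg_left h5 h6.le
      have h11 : 1 / (p : ℝ) * (1 - σ * Real.log p) = 1 / p - σ * (Real.log p / p) := by
        field_simp
      nlinarith [mul_nonneg h9 (sub_nonneg.2 h3)]
  have h2 : ∏ p ∈ primesUpTo x, Real.exp (2 * σ * (Real.log p / p)) ≤ Real.exp (2 * C) := by
    rw [← Real.exp_sum, Real.exp_le_exp, ← Finset.mul_sum]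
    calc 2 * σ * ∑ p ∈ primesUpTo x, Real.log p / p ≤ 2 * σ * (C * Real.log x) :=
          mul_le_mul_of_nonneg_left (hC' x hx) (by positivity)
      _ = 2 * C := by rw [hσ]; field_simp
  have h3 := prod_inv_one_sub_rpow_le hσ0 x
  have h4 : 1 + 1 / σ ≤ (1 / Real.log 2 + 1) * Real.log x := by
    rw [hσ, one_div_one_div, add_mul, one_mul, one_div_mul_eq_div]
    have : 1 ≤ Real.log x / Real.log 2 := (one_le_div hl2).2 hl'
    linarith
  have h5 : (eulerW x)⁻¹ ≤ ((1 / Real.log 2 + 1) * Real.exp (2 * C)) * Real.log x :=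
    calc (eulerW x)⁻¹ ≤ ((1 / Real.log 2 + 1) * Real.log x) * Real.exp (2 * C) :=
          h1.trans (mul_le_mul (h3.trans h4) h2 (Finset.prod_nonneg fun _ _ => (Real.exp_pos _).le)
            (by positivity))
      _ = _ := by ring
  rw [inv_le_comm₀ (by positivity) (mul_pos (eulerW_pos x) hl), mul_inv]
  rw [← div_eq_mul_inv]
  exact (div_le_iff₀ hl).2 h5

/-! ### Rough numbers and the upper bound sieve -/

open Classical in
/-- The integers `1 ≤ n ≤ x` all of whose prime factors exceed `y`. -/
noncomputable def roughUpTo (x y : ℝ) : Finset ℕ :=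
  {n ∈ Finset.Icc 1 ⌊x⌋₊ | ∀ p : ℕ, p.Prime → p ∣ n → y < p}

/-- `Φ(x, y)`, the number of integers `1 ≤ n ≤ x` all of whose prime factors exceed `y`. -/
noncomputable def roughCount (x y : ℝ) : ℝ := (roughUpTo x y).card

lemma mem_roughUpTo {x y : ℝ} {n : ℕ} :
    n ∈ roughUpTo x y ↔ 0 < n ∧ (n : ℝ) ≤ x ∧ ∀ p : ℕ, p.Prime → p ∣ n → y < p := by
  classical
  rw [roughUpTo, Finset.mem_filter, Finset.mem_Icc, and_assoc]
  constructor
  · rintro ⟨h1, h2, h3⟩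
    exact ⟨h1, (Nat.le_floor_iff' (by omega)).1 h2, h3⟩
  · rintro ⟨h1, h2, h3⟩
    exact ⟨h1, (Nat.le_floor_iff' (by omega)).2 h2, h3⟩

lemma roughCount_nonneg (x y : ℝ) : 0 ≤ roughCount x y := Nat.cast_nonneg _

lemma roughUpTo_anti_right {x y z : ℝ} (h : y ≤ z) : roughUpTo x z ⊆ roughUpTo x y := by
  intro n hn
  rw [mem_roughUpTo] at hn ⊢
  exact ⟨hn.1, hn.2.1, fun p hp hpn => h.trans_lt (hn.2.2 p hp hpn)⟩

/-- Chebyshev's device: `Σ log m` over rough `m ≤ x` is at most `Σ ψ(x/e)` over rough `e ≤ x`. -/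
lemma sum_log_rough_le (x y : ℝ) :
    ∑ m ∈ roughUpTo x y, Real.log m ≤ ∑ e ∈ roughUpTo x y, Chebyshev.psi (x / e) := by
  have h1 : ∀ m ∈ roughUpTo x y, Real.log m
      = ∑ d ∈ m.divisors, ArithmeticFunction.vonMangoldt d := fun m _ =>
    ArithmeticFunction.vonMangoldt_sum.symm
  have h2 : ∀ e ∈ roughUpTo x y, Chebyshev.psi (x / e)
      = ∑ d ∈ Finset.Ioc 0 ⌊x / e⌋₊, ArithmeticFunction.vonMangoldt d := fun _ _ => rfl
  rw [Finset.sum_congr rfl h1, Finset.sum_congr rfl h2, Finset.sum_sigma', Finset.sum_sigma']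
  let g : (Σ _ : ℕ, ℕ) → (Σ _ : ℕ, ℕ) := fun z => ⟨z.1 / z.2, z.2⟩
  have hg : Set.InjOn g ((roughUpTo x y).sigma fun m => m.divisors) := by
    rintro ⟨m, d⟩ hz ⟨m', d'⟩ hz' h
    simp only [Finset.coe_sigma, Set.mem_sigma_iff, Finset.mem_coe, Nat.mem_divisors] at hz hz'
    simp only [g, Sigma.mk.injEq, heq_eq_eq] at h
    obtain ⟨h, rfl⟩ := h
    have : m = m' := by
      rw [← Nat.div_mul_cancel hz.2.1, ← Nat.div_mul_cancel hz'.2.1, h]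
    subst this
    rfl
  rw [← Finset.sum_image (f := fun z : (Σ _ : ℕ, ℕ) => ArithmeticFunction.vonMangoldt z.2) hg]
  refine Finset.sum_le_sum_of_subset_of_nonneg (fun z hz => ?_) fun _ _ _ =>
    ArithmeticFunction.vonMangoldt_nonneg
  obtain ⟨⟨m, d⟩, hmd, rfl⟩ := Finset.mem_image.1 hz
  simp only [Finset.mem_sigma, Nat.mem_divisors, mem_roughUpTo] at hmd
  obtain ⟨⟨hm, hmx, hmp⟩, ⟨k, rfl⟩, -⟩ := hmd
  have hd : 0 < d := Nat.pos_of_mul_pos_right hm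
  have hk : 0 < k := Nat.pos_of_mul_pos_left hm
  have hd' : (1 : ℝ) ≤ d := by exact_mod_cast hd
  have hk' : (0 : ℝ) < k := by exact_mod_cast hk
  push_cast at hmx
  simp only [g, Finset.mem_sigma, mem_roughUpTo, Finset.mem_Ioc, Nat.mul_div_cancel_left _ hd]
  refine ⟨⟨hk, ?_, fun p hp hpk => hmp p hp (hpk.mul_left _)⟩, hd, ?_⟩
  · nlinarith
  · rw [Nat.le_floor_iff' hd.ne', le_div_iff₀ hk']
    exact hmx

/-- The sum of reciprocals over rough numbers is at most `W(y) / W(x)`. -/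
lemma sum_one_div_rough_le {x y : ℝ} (hyx : y ≤ x) :
    ∑ n ∈ roughUpTo x y, 1 / (n : ℝ) ≤ eulerW y / eulerW x := by
  rw [eulerW_eq_mul hyx, ← div_div, div_self (eulerW_pos y).ne', one_div]
  refine sum_one_div_le_prod_inv
    (fun p hp => (mem_primesUpTo.1 (Finset.mem_sdiff.1 hp).1).1) fun n hn => ?_
  rw [mem_roughUpTo] at hn
  rw [Nat.mem_factoredNumbers]
  refine ⟨hn.1.ne', fun p hp => ?_⟩
  have hp' := Nat.prime_of_mem_primeFactorsList hp
  have hpn := Nat.dvd_of_mem_primeFactorsList hp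
  rw [Finset.mem_sdiff, mem_primesUpTo, mem_primesUpTo]
  refine ⟨⟨hp', le_trans ?_ hn.2.1⟩, fun h => (hn.2.2 p hp' hpn).not_ge h.2⟩
  exact_mod_cast Nat.le_of_dvd hn.1 hpn

/-- The upper bound sieve: `Φ(x, y) ≪ x W(y)` uniformly for `y ≤ x`. -/
lemma exists_roughCount_le :
    ∃ C : ℝ, 0 < C ∧ ∀ x y : ℝ, 2 ≤ x → y ≤ x → roughCount x y ≤ C * (x * eulerW y) := by
  obtain ⟨c, hc, hc'⟩ := exists_le_eulerW_mul_log
  have hl4 : 0 < Real.log 4 := Real.log_pos (by norm_num)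
  refine ⟨(Real.log 4 + 5) / c, by positivity, fun x y hx hyx => ?_⟩
  have hl : 0 < Real.log x := Real.log_pos (by linarith)
  have hx0 : 0 < x := by linarith
  have h1 : roughCount x y * Real.log x
      = ∑ m ∈ roughUpTo x y, Real.log m + ∑ m ∈ roughUpTo x y, Real.log (x / m) := by
    rw [← Finset.sum_add_distrib, roughCount, ← nsmul_eq_mul, ← Finset.sum_const]
    refine Finset.sum_congr rfl fun m hm => ?_
    have : (m : ℝ) ≠ 0 := by exact_mod_cast (mem_roughUpTo.1 hm).1.ne'
    rw [Real.log_div hx0.ne' this]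
    ring
  have h2 : roughCount x y * Real.log x
      ≤ (Real.log 4 + 5) * (x * ∑ n ∈ roughUpTo x y, 1 / (n : ℝ)) := by
    have h3 : (Real.log 4 + 5) * (x * ∑ n ∈ roughUpTo x y, 1 / (n : ℝ))
        = ∑ n ∈ roughUpTo x y, (Real.log 4 + 4) * (x / n) + ∑ n ∈ roughUpTo x y, x / n := by
      rw [Finset.mul_sum, Finset.mul_sum, ← Finset.sum_add_distrib]
      exact Finset.sum_congr rfl fun n _ => by ring
    rw [h1, h3]
    refine add_le_add ((sum_log_rough_le x y).trans ?_) ?_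
    · exact Finset.sum_le_sum fun n _ => Chebyshev.psi_le_const_mul_self (by positivity)
    · refine Finset.sum_le_sum fun n hn => ?_
      have : (0 : ℝ) < n := by exact_mod_cast (mem_roughUpTo.1 hn).1
      linarith [Real.log_le_sub_one_of_pos (div_pos hx0 this)]
  have h3 := mul_le_mul_of_nonneg_left (sum_one_div_rough_le hyx) hx0.le
  have h4 := h2.trans (mul_le_mul_of_nonneg_left h3 (by positivity))
  have hW := eulerW_pos x
  have hWy := eulerW_pos y
  rw [← le_div_iff₀ hl] at h4
  refine h4.trans ?_
  have h5 := hc' x hx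
  calc (Real.log 4 + 5) * (x * (eulerW y / eulerW x)) / Real.log x
      = (Real.log 4 + 5) * (x * eulerW y) / (eulerW x * Real.log x) := by field_simp
    _ ≤ (Real.log 4 + 5) * (x * eulerW y) / c := by gcongr
    _ = _ := by ring

/-! ### Sieving by the primes of an interval -/

/-- The primes `y < p ≤ z`. -/
noncomputable def primesBetween (y z : ℝ) : Finset ℕ := primesUpTo z \ primesUpTo y

lemma mem_primesBetween {y z : ℝ} {p : ℕ} :
    p ∈ primesBetween y z ↔ p.Prime ∧ y < p ∧ (p : ℝ) ≤ z := by
  rw [primesBetween, Finset.mem_sdiff, mem_primesUpTo, mem_primesUpTo]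
  constructor
  · rintro ⟨⟨h1, h2⟩, h3⟩
    exact ⟨h1, not_le.1 fun h => h3 ⟨h1, h⟩, h2⟩
  · rintro ⟨h1, h2, h3⟩
    exact ⟨⟨h1, h3⟩, fun h => h2.not_ge h.2⟩

/-- The product of a finite set of primes. Squarefree divisors in the sieve are encoded by their
sets of prime factors. -/
def primeProd (S : Finset ℕ) : ℕ := ∏ p ∈ S, p

lemma primeProd_pos {S : Finset ℕ} (hS : ∀ p ∈ S, p.Prime) : 0 < primeProd S :=
  Finset.prod_pos fun p hp => (hS p hp).pos

lemma primeProd_dvd_iff {S : Finset ℕ} (hS : ∀ p ∈ S, p.Prime) {m : ℕ} :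
    primeProd S ∣ m ↔ ∀ p ∈ S, p ∣ m :=
  ⟨fun h _ hp => (Finset.dvd_prod_of_mem _ hp).trans h,
    fun h => Finset.prod_primes_dvd m (fun _ hp => (hS _ hp).prime) h⟩

/-- Multiples of `∏ S` among the `y`-rough numbers up to `x`, when the primes in `S` exceed `y`. -/
lemma card_rough_multiples {S : Finset ℕ} {x y : ℝ} (hS : ∀ p ∈ S, p.Prime ∧ y < p) :
    (((roughUpTo x y).filter fun m => primeProd S ∣ m).card : ℝ)
      = roughCount (x / primeProd S) y := by
  have hd := primeProd_pos fun p hp => (hS p hp).1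
  have hd' : (0 : ℝ) < primeProd S := by exact_mod_cast hd
  rw [roughCount, Nat.cast_inj]
  symm
  refine Finset.card_bij (fun k _ => primeProd S * k) (fun k hk => ?_) (fun a _ b _ h => ?_)
    fun m hm => ?_
  · rw [mem_roughUpTo] at hk
    rw [Finset.mem_filter, mem_roughUpTo]
    refine ⟨⟨Nat.mul_pos hd hk.1, ?_, fun p hp h => ?_⟩, dvd_mul_right _ _⟩
    · rw [le_div_iff₀ hd'] at hk
      push_cast
      linarith [hk.2.1]
    · rcases hp.dvd_mul.1 h with h | h
      · obtain ⟨q, hq, hpq⟩ := (hp.prime.dvd_finsetProd_iff _).1 h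
        rw [(Nat.prime_dvd_prime_iff_eq hp (hS q hq).1).1 hpq]
        exact (hS q hq).2
      · exact hk.2.2 p hp h
  · exact Nat.eq_of_mul_eq_mul_left hd h
  · rw [Finset.mem_filter, mem_roughUpTo] at hm
    obtain ⟨⟨h1, h2, h3⟩, k, rfl⟩ := hm
    refine ⟨k, mem_roughUpTo.2 ⟨Nat.pos_of_mul_pos_left h1, ?_, fun p hp h =>
      h3 p hp (h.mul_left _)⟩, rfl⟩
    rw [le_div_iff₀ hd']
    push_cast at h2
    linarith

/-- Legendre's identity, relative to the primes up to `y`. -/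
lemma roughCount_eq_sum {x y z : ℝ} (hyz : y ≤ z) :
    roughCount x z = ∑ S ∈ (primesBetween y z).powerset,
      (-1 : ℝ) ^ S.card * roughCount (x / primeProd S) y := by
  have h1 : ∀ S ∈ (primesBetween y z).powerset, (-1 : ℝ) ^ S.card * roughCount (x / primeProd S) y
      = ∑ m ∈ roughUpTo x y, if primeProd S ∣ m then (-1 : ℝ) ^ S.card else 0 := by
    intro S hS
    rw [← card_rough_multiples fun p hp => ⟨(mem_primesBetween.1 (Finset.mem_powerset.1 hS hp)).1,
      (mem_primesBetween.1 (Finset.mem_powerset.1 hS hp)).2.1⟩, ← Finset.sum_filter,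
      Finset.sum_const, nsmul_eq_mul, mul_comm]
  rw [Finset.sum_congr rfl h1, Finset.sum_comm]
  have h2 : ∀ m ∈ roughUpTo x y, (∑ S ∈ (primesBetween y z).powerset,
      if primeProd S ∣ m then (-1 : ℝ) ^ S.card else 0)
      = if m ∈ roughUpTo x z then 1 else 0 := by
    intro m hm
    have h3 : (primesBetween y z).powerset.filter (fun S => primeProd S ∣ m)
        = ((primesBetween y z).filter fun p => p ∣ m).powerset := by
      ext S
      rw [Finset.mem_filter, Finset.mem_powerset, Finset.mem_powerset]
      constructor
      · rintro ⟨hS, h⟩ p hp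
        exact Finset.mem_filter.2 ⟨hS hp, (primeProd_dvd_iff fun p hp =>
          (mem_primesBetween.1 (hS hp)).1).1 h p hp⟩
      · intro hS
        have hS' : S ⊆ primesBetween y z := fun p hp => (Finset.mem_filter.1 (hS hp)).1
        exact ⟨hS', (primeProd_dvd_iff fun p hp => (mem_primesBetween.1 (hS' hp)).1).2
          fun p hp => (Finset.mem_filter.1 (hS hp)).2⟩
    rw [← Finset.sum_filter, h3]
    have h4 := congrArg (Int.cast : ℤ → ℝ)
      (Finset.sum_powerset_neg_one_pow_card (x := (primesBetween y z).filter fun p => p ∣ m))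
    push_cast at h4
    rw [h4]
    refine if_congr ?_ rfl rfl
    rw [mem_roughUpTo] at hm ⊢
    rw [Finset.filter_eq_empty_iff]
    constructor
    · intro h
      refine ⟨hm.1, hm.2.1, fun p hp hpm => not_le.1 fun hpz => ?_⟩
      exact h (mem_primesBetween.2 ⟨hp, hm.2.2 p hp hpm, hpz⟩) hpm
    · intro h p hp hpm
      rw [mem_primesBetween] at hp
      exact (h.2.2 p hp.1 hpm).not_ge hp.2.2
  rw [Finset.sum_congr rfl h2, ← Finset.sum_filter, Finset.filter_mem_eq_inter,
    Finset.inter_eq_right.2 (roughUpTo_anti_right hyz), Finset.sum_const, nsmul_eq_mul, mul_one,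
    roughCount]

lemma eulerW_eq_sum {y z : ℝ} (hyz : y ≤ z) :
    eulerW z = ∑ S ∈ (primesBetween y z).powerset,
      (-1 : ℝ) ^ S.card * (1 / primeProd S * eulerW y) := by
  have h := Finset.prod_one_add (f := fun p : ℕ => -(1 / (p : ℝ))) (primesBetween y z)
  rw [eulerW_eq_mul hyz]
  simp only [sub_eq_add_neg]
  rw [show primesUpTo z \ primesUpTo y = primesBetween y z from rfl, h, Finset.mul_sum]
  refine Finset.sum_congr rfl fun S _ => ?_
  rw [Finset.prod_neg, primeProd, Nat.cast_prod, Finset.prod_div_distrib, Finset.prod_const_one]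
  ring

lemma sum_powerset_one_div_le {y z : ℝ} (hyz : y ≤ z) :
    ∑ S ∈ (primesBetween y z).powerset, 1 / (primeProd S : ℝ) ≤ eulerW y / eulerW z := by
  have h := Finset.prod_one_add (f := fun p : ℕ => 1 / (p : ℝ)) (primesBetween y z)
  have h1 : ∑ S ∈ (primesBetween y z).powerset, 1 / (primeProd S : ℝ)
      = ∏ p ∈ primesBetween y z, (1 + 1 / (p : ℝ)) := by
    rw [h]
    refine Finset.sum_congr rfl fun S _ => ?_
    rw [primeProd, Nat.cast_prod, Finset.prod_div_distrib, Finset.prod_const_one]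
  rw [h1, eulerW_eq_mul hyz, ← div_div, div_self (eulerW_pos y).ne', one_div, ←
    Finset.prod_inv_distrib]
  refine Finset.prod_le_prod (fun p _ => by positivity) fun p hp => ?_
  have hp' := one_sub_one_div_prime_pos (mem_primesBetween.1 hp).1
  have h2 : (0 : ℝ) ≤ 1 / p := by positivity
  rw [← one_div, le_div_iff₀ hp']
  nlinarith

/-- Rankin's trick: the tail `∏ S > D` of `Σ 1 / ∏ S` is small in terms of `log D / log z`. -/
lemma sum_tail_one_div_le {y z D κ : ℝ} {N : ℕ} (hyz : y ≤ z) (hz : 1 < z) (hD : 0 < D)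
    (hκ : 0 ≤ κ) (hN : Real.exp κ ≤ N) :
    ∑ S ∈ (primesBetween y z).powerset with D < (primeProd S : ℝ), 1 / (primeProd S : ℝ)
      ≤ Real.exp (-(κ / Real.log z * Real.log D)) * (eulerW y / eulerW z) ^ N := by
  have hlz : 0 < Real.log z := Real.log_pos hz
  set η := κ / Real.log z with hη
  have hη0 : 0 ≤ η := by positivity
  have hpos : ∀ S ∈ (primesBetween y z).powerset, (0 : ℝ) < primeProd S := fun S hS => by
    exact_mod_cast primeProd_pos fun p hp => (mem_primesBetween.1 (Finset.mem_powerset.1 hS hp)).1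
  calc ∑ S ∈ (primesBetween y z).powerset with D < (primeProd S : ℝ), 1 / (primeProd S : ℝ)
      ≤ ∑ S ∈ (primesBetween y z).powerset with D < (primeProd S : ℝ),
          Real.exp (-(η * Real.log D)) * ((primeProd S : ℝ) ^ η / primeProd S) := by
        refine Finset.sum_le_sum fun S hS => ?_
        rw [Finset.mem_filter] at hS
        have h0 := hpos S hS.1
        rw [← mul_div_assoc]
        refine div_le_div_of_nonneg_right ?_ h0.le
        rw [Real.rpow_def_of_pos h0, ← Real.exp_add]
        refine Real.one_le_exp ?_
        have := mul_le_mul_of_nonneg_left (Real.log_le_log hD hS.2.le) hη0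
        linarith
    _ ≤ ∑ S ∈ (primesBetween y z).powerset,
          Real.exp (-(η * Real.log D)) * ((primeProd S : ℝ) ^ η / primeProd S) :=
        Finset.sum_le_sum_of_subset_of_nonneg (Finset.filter_subset _ _) fun S _ _ => by positivity
    _ = Real.exp (-(η * Real.log D)) * ∏ p ∈ primesBetween y z, (1 + (p : ℝ) ^ η / p) := by
        rw [Finset.prod_one_add, Finset.mul_sum]
        refine Finset.sum_congr rfl fun S hS => ?_
        rw [primeProd, Nat.cast_prod, Finset.prod_div_distrib, Real.finsetProd_rpow]
        exact fun p _ => Nat.cast_nonneg p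
    _ ≤ _ := by
        refine mul_le_mul_of_nonneg_left ?_ (Real.exp_pos _).le
        rw [eulerW_eq_mul hyz, ← div_div, div_self (eulerW_pos y).ne', one_div, ←
          Finset.prod_inv_distrib, ← Finset.prod_pow]
        refine Finset.prod_le_prod (fun p _ => by positivity) fun p hp => ?_
        have hp1 := mem_primesBetween.1 hp
        have hp' := one_sub_one_div_prime_pos hp1.1
        have hp0 : (0 : ℝ) < p := by exact_mod_cast hp1.1.pos
        have h2 : (0 : ℝ) ≤ 1 / p := by positivity
        have h3 : (p : ℝ) ^ η ≤ N := by
          refine le_trans ?_ hN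
          rw [Real.rpow_def_of_pos hp0, Real.exp_le_exp]
          calc Real.log p * η ≤ Real.log z * η :=
                mul_le_mul_of_nonneg_right (Real.log_le_log hp0 hp1.2.2) hη0
            _ = κ := by rw [hη]; field_simp
        calc 1 + (p : ℝ) ^ η / p ≤ 1 + N * (1 / p) := by
              rw [mul_one_div]
              gcongr
          _ ≤ (1 + 1 / (p : ℝ)) ^ N := one_add_mul_le_pow (by linarith) N
          _ ≤ ((1 - 1 / (p : ℝ))⁻¹) ^ N := by
              refine pow_le_pow_left₀ (by positivity) ?_ N
              rw [← one_div, le_div_iff₀ hp']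
              nlinarith

/-- A product of primes `≤ z` exceeding `D` has a subproduct in `(D, Dz]`. -/
lemma exists_subset_primeProd {D z : ℝ} (hD : 1 ≤ D) (S : Finset ℕ)
    (hS : ∀ p ∈ S, p.Prime ∧ (p : ℝ) ≤ z) (hDS : D < primeProd S) :
    ∃ T ⊆ S, D < primeProd T ∧ (primeProd T : ℝ) ≤ D * z := by
  induction S using Finset.induction_on with
  | empty =>
    simp only [primeProd, Finset.prod_empty, Nat.cast_one] at hDS
    linarith
  | insert p S hpS ih =>
    by_cases h : D < primeProd S
    · obtain ⟨T, hT, h1⟩ := ih (fun q hq => hS q (Finset.mem_insert_of_mem hq)) h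
      exact ⟨T, hT.trans (Finset.subset_insert _ _), h1⟩
    · refine ⟨_, subset_rfl, hDS, ?_⟩
      rw [primeProd, Finset.prod_insert hpS, Nat.cast_mul, mul_comm]
      exact mul_le_mul (not_lt.1 h) (hS p (Finset.mem_insert_self _ _)).2 (by positivity)
        (by linarith)

/-- The terms `∏ S > D` of Legendre's identity are controlled by those with `D < ∏ T ≤ Dz`, at the
cost of a factor bounding the number of squarefree divisors of an integer `m ≤ x` that are composed
of primes exceeding `y`. -/
lemma sum_tail_roughCount_le {x y z D B : ℝ} (hy : 0 ≤ y) (hD : 1 ≤ D)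
    (hB : ∀ k : ℕ, y ^ k ≤ x → (2 : ℝ) ^ k ≤ B) :
    ∑ S ∈ (primesBetween y z).powerset with D < (primeProd S : ℝ), roughCount (x / primeProd S) y
      ≤ B * ∑ S ∈ (primesBetween y z).powerset with
          D < (primeProd S : ℝ) ∧ (primeProd S : ℝ) ≤ D * z, roughCount (x / primeProd S) y := by
  have key : ∀ S ∈ (primesBetween y z).powerset, roughCount (x / primeProd S) y
      = ∑ m ∈ roughUpTo x y, if primeProd S ∣ m then (1 : ℝ) else 0 := by
    intro S hS
    rw [← card_rough_multiples fun p hp => ⟨(mem_primesBetween.1 (Finset.mem_powerset.1 hS hp)).1,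
      (mem_primesBetween.1 (Finset.mem_powerset.1 hS hp)).2.1⟩, ← Finset.sum_filter,
      Finset.sum_const, nsmul_eq_mul, mul_one]
  rw [Finset.sum_congr rfl fun S hS => key S (Finset.mem_filter.1 hS).1,
    Finset.sum_congr rfl fun S hS => key S (Finset.mem_filter.1 hS).1, Finset.sum_comm,
    Finset.sum_comm (t := roughUpTo x y), Finset.mul_sum]
  refine Finset.sum_le_sum fun m hm => ?_
  rw [← Finset.sum_filter, ← Finset.sum_filter, Finset.filter_filter, Finset.filter_filter,
    Finset.sum_const, Finset.sum_const, nsmul_eq_mul, nsmul_eq_mul, mul_one, mul_one]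
  rw [mem_roughUpTo] at hm
  set Q := (primesBetween y z).filter fun p => p ∣ m with hQ
  have hprime : ∀ S ⊆ primesBetween y z, ∀ p ∈ S, p.Prime := fun S hS p hp =>
    (mem_primesBetween.1 (hS hp)).1
  have hQsub : Q ⊆ primesBetween y z := Finset.filter_subset _ _
  have hBQ : (2 : ℝ) ^ Q.card ≤ B := by
    refine hB _ ?_
    calc y ^ Q.card ≤ ∏ p ∈ Q, (p : ℝ) := by
          rw [← Finset.prod_const]
          exact Finset.prod_le_prod (fun _ _ => hy) fun p hp =>
            (mem_primesBetween.1 (hQsub hp)).2.1.le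
      _ = (primeProd Q : ℝ) := by rw [primeProd, Nat.cast_prod]
      _ ≤ m := by
          exact_mod_cast Nat.le_of_dvd hm.1 ((primeProd_dvd_iff (hprime Q hQsub)).2
            fun p hp => (Finset.mem_filter.1 hp).2)
      _ ≤ x := hm.2.1
  by_cases hne : ∃ S ∈ (primesBetween y z).powerset, D < (primeProd S : ℝ) ∧ primeProd S ∣ m
  · obtain ⟨S, hS, hDS, hSm⟩ := hne
    rw [Finset.mem_powerset] at hS
    obtain ⟨T, hTS, hT⟩ := exists_subset_primeProd (z := z) hD S
      (fun p hp => ⟨hprime S hS p hp, (mem_primesBetween.1 (hS hp)).2.2⟩) hDS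
    have hTm : primeProd T ∣ m := (primeProd_dvd_iff (hprime T (hTS.trans hS))).2 fun p hp =>
      (primeProd_dvd_iff (hprime S hS)).1 hSm p (hTS hp)
    have h1 : (1 : ℝ) ≤ (((primesBetween y z).powerset.filter fun S =>
        (D < (primeProd S : ℝ) ∧ (primeProd S : ℝ) ≤ D * z) ∧ primeProd S ∣ m).card : ℝ) := by
      refine Nat.one_le_cast.2 (Finset.card_pos.2 ⟨T, Finset.mem_filter.2 ⟨?_, hT, hTm⟩⟩)
      exact Finset.mem_powerset.2 (hTS.trans hS)
    have h2 : (((primesBetween y z).powerset.filter fun S =>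
        D < (primeProd S : ℝ) ∧ primeProd S ∣ m).card : ℝ) ≤ 2 ^ Q.card := by
      rw [← Nat.cast_ofNat, ← Nat.cast_pow, Nat.cast_le, ← Finset.card_powerset]
      refine Finset.card_le_card fun S hS => ?_
      rw [Finset.mem_filter, Finset.mem_powerset] at hS
      exact Finset.mem_powerset.2 fun p hp => Finset.mem_filter.2 ⟨hS.1 hp,
        (primeProd_dvd_iff (hprime S hS.1)).1 hS.2.2 p hp⟩
    have hB0 : 0 ≤ B := le_trans (by positivity) hBQ
    exact (h2.trans hBQ).trans (le_mul_of_one_le_right hB0 h1)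
  · have : ((primesBetween y z).powerset.filter fun S =>
        D < (primeProd S : ℝ) ∧ primeProd S ∣ m) = ∅ :=
      Finset.filter_eq_empty_iff.2 fun S hS h => hne ⟨S, hS, h⟩
    rw [this, Finset.card_empty, Nat.cast_zero]
    have hB0 : 0 ≤ B := le_trans (by positivity) hBQ
    positivity

/-! ### The fundamental lemma of the sieve -/

/-- `2^{us} e^{-(s+1)u} ≤ e^{-u} ≤ 6 / u³`. -/
lemma exp_mul_exp_le {s u : ℝ} (hs : 0 ≤ s) (hu : 0 < u) :
    Real.exp (Real.log 2 * (s * u)) * Real.exp (-((s + 1) * u)) ≤ 6 * (1 / u) ^ 3 := by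
  have h1 := Real.pow_div_factorial_le_exp u hu.le 3
  have h2 : Real.log 2 * (s * u) ≤ s * u :=
    mul_le_of_le_one_left (by positivity) (by linarith [Real.log_two_lt_d9])
  rw [← Real.exp_add]
  calc Real.exp (Real.log 2 * (s * u) + -((s + 1) * u)) ≤ Real.exp (-u) :=
        Real.exp_le_exp.2 (by linarith)
    _ = 1 / Real.exp u := by rw [Real.exp_neg, one_div]
    _ ≤ 1 / (u ^ 3 / (3).factorial) := one_div_le_one_div_of_le (by positivity) h1
    _ = 6 * (1 / u) ^ 3 := by
        simp only [Nat.factorial]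
        field_simp
        norm_num

/-- The induction step: an estimate for the sieve up to `y₁ = y^{1/s}` gives one up to `y`. Since
the bound for `Φ(·, y₁)` is smaller by a factor `s³`, it is improved even after the loss of
`(W(y₁)/W(y))² ≪ s²`. -/
lemma abs_roughCount_sub_le_step {A C x y y₁ : ℝ} {s N : ℕ} (hs : 1 ≤ s) (hA : 0 ≤ A)
    (hC : 0 ≤ C) (hCb : ∀ x y : ℝ, 2 ≤ x → y ≤ x → roughCount x y ≤ C * (x * eulerW y))
    (hy : 2 ≤ y) (hxy : y ^ 4 ≤ x) (hy₁ : 1 < y₁) (hlog : s * Real.log y₁ = Real.log y)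
    (hN : Real.exp (2 * (s + 1)) ≤ N)
    (hIH : ∀ z : ℝ, y₁ ≤ z →
      |roughCount z y₁ - z * eulerW y₁| ≤ A * (z * eulerW y₁ * (Real.log y₁ / Real.log z) ^ 3)) :
    |roughCount x y - x * eulerW y| ≤ (8 * A / s ^ 3 * (eulerW y₁ / eulerW y) ^ 2
        + 6 * (C + 1) * (eulerW y₁ / eulerW y) ^ (N + 1))
      * (x * eulerW y * (Real.log y / Real.log x) ^ 3) := by
  have hs0 : (0 : ℝ) < s := by exact_mod_cast hs
  have hly : 0 < Real.log y := Real.log_pos (by linarith)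
  have hly₁ : 0 < Real.log y₁ := Real.log_pos hy₁
  have hyy₁ : y₁ ≤ y := by
    rw [← Real.log_le_log_iff (by linarith) (by linarith), ← hlog]
    exact le_mul_of_one_le_left hly₁.le (by exact_mod_cast hs)
  have hxy' : y ≤ x := (le_self_pow₀ (by linarith) (by norm_num)).trans hxy
  have hx0 : 0 < x := by linarith
  have hlx : 0 < Real.log x := Real.log_pos (by linarith)
  have hW := eulerW_pos y
  have hW₁ := eulerW_pos y₁
  set V := eulerW y₁ / eulerW y with hV
  have hV0 : 0 < V := by positivity
  have hWV : eulerW y₁ = V * eulerW y := by rw [hV]; field_simp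
  set D := Real.sqrt x with hDdef
  have hDD : D * D = x := Real.mul_self_sqrt hx0.le
  have hDy : y ^ 2 ≤ D := Real.le_sqrt_of_sq_le (by linarith [show (y ^ 2) ^ 2 = y ^ 4 by ring])
  have hD2 : y * 1 ≤ y ^ 2 := by rw [sq]; gcongr; linarith
  have hD1 : 1 ≤ D := by linarith
  have hlD : Real.log D = Real.log x / 2 := Real.log_sqrt hx0.le
  set P := (primesBetween y₁ y).powerset with hP
  have hpos : ∀ S ∈ P, (0 : ℝ) < primeProd S := fun S hS => by
    exact_mod_cast primeProd_pos fun p hp => (mem_primesBetween.1 (Finset.mem_powerset.1 hS hp)).1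
  set u := Real.log x / Real.log y with hu
  have hu0 : 0 < u := by positivity
  have hlu : Real.log y / Real.log x = 1 / u := by rw [hu, one_div_div]
  -- Rankin's bound for the tail of `Σ 1 / ∏ S`, with `κ = 2 (s + 1)` so that it outweighs the
  -- divisor bound `B = 2^{us}` below
  have hR := sum_tail_one_div_le (y := y₁) (z := y) (D := D) (κ := 2 * (s + 1)) (N := N) hyy₁
    (by linarith) (by linarith) (by positivity) hN
  have hRexp : 2 * ((s : ℝ) + 1) / Real.log y * Real.log D = (s + 1) * u := by
    rw [hlD, hu]; field_simp
  rw [hRexp, ← hV, ← hP] at hR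
  set E := Real.exp (-(((s : ℝ) + 1) * u)) with hE
  set B := Real.exp (Real.log 2 * (s * u)) with hBdef
  have hB1 : 1 ≤ B := Real.one_le_exp (by have := Real.log_pos one_lt_two; positivity)
  have hBE : B * E ≤ 6 * (1 / u) ^ 3 := exp_mul_exp_le hs0.le hu0
  -- an integer up to `x` has at most `us` prime factors exceeding `y₁`
  have hB : ∀ k : ℕ, y₁ ^ k ≤ x → (2 : ℝ) ^ k ≤ B := by
    intro k hk
    have h1 : k * Real.log y₁ ≤ Real.log x := by
      rw [← Real.log_pow]
      exact Real.log_le_log (by positivity) hk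
    have h2 : (k : ℝ) ≤ s * u := by
      rw [hu, ← mul_div_assoc, le_div_iff₀ hly, ← hlog]
      nlinarith
    rw [← Real.rpow_natCast, Real.rpow_def_of_pos two_pos, hBdef, Real.exp_le_exp]
    exact mul_le_mul_of_nonneg_left h2 (Real.log_pos one_lt_two).le
  -- the error of the sieve is distributed over the divisors `∏ S`
  have h1 : roughCount x y - x * eulerW y = ∑ S ∈ P, (-1 : ℝ) ^ S.card *
      (roughCount (x / primeProd S) y₁ - x / primeProd S * eulerW y₁) := by
    rw [roughCount_eq_sum hyy₁, eulerW_eq_sum hyy₁, Finset.mul_sum, ← Finset.sum_sub_distrib]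
    exact Finset.sum_congr rfl fun S _ => by ring
  have h2 : |roughCount x y - x * eulerW y| ≤ ∑ S ∈ P,
      |roughCount (x / primeProd S) y₁ - x / primeProd S * eulerW y₁| := by
    rw [h1]
    refine (Finset.abs_sum_le_sum_abs _ _).trans (le_of_eq (Finset.sum_congr rfl fun S _ => ?_))
    rw [abs_mul, abs_pow, abs_neg, abs_one, one_pow, one_mul]
  rw [← Finset.sum_filter_not_add_sum_filter P (fun S => D < (primeProd S : ℝ))] at h2
  -- divisors up to `D = √x`: the hypothesis for `y₁` applies
  have h3 : ∑ S ∈ P with ¬ D < (primeProd S : ℝ),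
      |roughCount (x / primeProd S) y₁ - x / primeProd S * eulerW y₁|
      ≤ 8 * A / s ^ 3 * V ^ 2 * (x * eulerW y * (1 / u) ^ 3) := by
    calc _ ≤ ∑ S ∈ P with ¬ D < (primeProd S : ℝ),
          A * (x * eulerW y₁ * (8 / s ^ 3 * (1 / u) ^ 3)) * (1 / primeProd S) := by
          refine Finset.sum_le_sum fun S hS => ?_
          rw [Finset.mem_filter, not_lt] at hS
          have h0 := hpos S hS.1
          have hz : D ≤ x / primeProd S := by
            rw [le_div_iff₀ h0, ← hDD]
            exact mul_le_mul_of_nonneg_left hS.2 (by linarith)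
          have hlz : Real.log x / 2 ≤ Real.log (x / primeProd S) := by
            rw [← hlD]; exact Real.log_le_log (by linarith) hz
          refine (hIH _ (by linarith)).trans ?_
          have h4 : Real.log y₁ / Real.log (x / primeProd S) ≤ 2 / s * (1 / u) := by
            rw [div_le_iff₀ (by linarith)]
            calc Real.log y₁ = 2 / s * (1 / u) * (Real.log x / 2) := by
                  rw [hu, ← hlog]; field_simp
              _ ≤ _ := mul_le_mul_of_nonneg_left hlz (by positivity)
          have h5 : (Real.log y₁ / Real.log (x / primeProd S)) ^ 3 ≤ 8 / s ^ 3 * (1 / u) ^ 3 := by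
            calc _ ≤ (2 / s * (1 / u)) ^ 3 :=
                  pow_le_pow_left₀ (div_nonneg hly₁.le (by linarith)) h4 3
              _ = _ := by ring
          calc A * (x / primeProd S * eulerW y₁
                * (Real.log y₁ / Real.log (x / primeProd S)) ^ 3)
              ≤ A * (x / primeProd S * eulerW y₁ * (8 / s ^ 3 * (1 / u) ^ 3)) := by gcongr
            _ = _ := by ring
      _ ≤ ∑ S ∈ P, A * (x * eulerW y₁ * (8 / s ^ 3 * (1 / u) ^ 3)) * (1 / primeProd S) :=
          Finset.sum_le_sum_of_subset_of_nonneg (Finset.filter_subset _ _)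
            fun S _ _ => by positivity
      _ ≤ A * (x * eulerW y₁ * (8 / s ^ 3 * (1 / u) ^ 3)) * V := by
          rw [← Finset.mul_sum]
          exact mul_le_mul_of_nonneg_left (sum_powerset_one_div_le hyy₁) (by positivity)
      _ = _ := by rw [hWV]; ring
  -- divisors above `D`: the upper bound sieve and Rankin's bound apply
  have h4 : ∑ S ∈ P with D < (primeProd S : ℝ), roughCount (x / primeProd S) y₁
      ≤ B * (C * (x * eulerW y₁) * (E * V ^ N)) := by
    refine (sum_tail_roughCount_le (by linarith) hD1 hB).trans
      (mul_le_mul_of_nonneg_left ?_ (by linarith))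
    calc _ ≤ ∑ S ∈ P with D < (primeProd S : ℝ) ∧ (primeProd S : ℝ) ≤ D * y,
          C * (x * eulerW y₁) * (1 / primeProd S) := by
          refine Finset.sum_le_sum fun S hS => ?_
          rw [Finset.mem_filter] at hS
          have h0 := hpos S hS.1
          have hz : y ≤ x / primeProd S := by
            rw [le_div_iff₀ h0, ← hDD]
            calc y * primeProd S ≤ y * (D * y) :=
                  mul_le_mul_of_nonneg_left hS.2.2 (by linarith)
              _ = y ^ 2 * D := by ring
              _ ≤ D * D := mul_le_mul_of_nonneg_right hDy (by linarith)
          refine (hCb _ _ (by linarith) (by linarith)).trans (le_of_eq ?_)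
          ring
      _ ≤ ∑ S ∈ P with D < (primeProd S : ℝ), C * (x * eulerW y₁) * (1 / primeProd S) :=
          Finset.sum_le_sum_of_subset_of_nonneg
            (Finset.monotone_filter_right _ fun S _ hS => hS.1) fun S _ _ => by positivity
      _ ≤ _ := by
          rw [← Finset.mul_sum]
          exact mul_le_mul_of_nonneg_left hR (by positivity)
  have h5 : ∑ S ∈ P with D < (primeProd S : ℝ),
      |roughCount (x / primeProd S) y₁ - x / primeProd S * eulerW y₁|
      ≤ 6 * (C + 1) * V ^ (N + 1) * (x * eulerW y * (1 / u) ^ 3) := by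
    calc _ ≤ ∑ S ∈ P with D < (primeProd S : ℝ), (roughCount (x / primeProd S) y₁
          + x * eulerW y₁ * (1 / primeProd S)) := by
          refine Finset.sum_le_sum fun S hS => (abs_sub _ _).trans (le_of_eq ?_)
          rw [abs_of_nonneg (roughCount_nonneg _ _), abs_of_nonneg (by positivity)]
          ring
      _ ≤ B * (C * (x * eulerW y₁) * (E * V ^ N)) + x * eulerW y₁ * (E * V ^ N) := by
          rw [Finset.sum_add_distrib, ← Finset.mul_sum]
          exact add_le_add h4 (mul_le_mul_of_nonneg_left hR (by positivity))
      _ ≤ B * (C * (x * eulerW y₁) * (E * V ^ N)) + B * (x * eulerW y₁ * (E * V ^ N)) := by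
          exact add_le_add le_rfl (le_mul_of_one_le_left (by positivity) hB1)
      _ = (C + 1) * V ^ (N + 1) * (x * eulerW y) * (B * E) := by rw [hWV]; ring
      _ ≤ (C + 1) * V ^ (N + 1) * (x * eulerW y) * (6 * (1 / u) ^ 3) := by gcongr
      _ = _ := by ring
  rw [hlu]
  calc _ ≤ _ := h2.trans (add_le_add h3 h5)
    _ = _ := by ring

lemma abs_roughCount_sub_le_of_lt_two {l x y : ℝ} (hl : 0 < l) (hly : l ≤ Real.log y) (hy : 1 < y)
    (hy2 : y < 2) (hyx : y ≤ x) :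
    |roughCount x y - x * eulerW y|
      ≤ 6 / l ^ 3 * (x * eulerW y * (Real.log y / Real.log x) ^ 3) := by
  have hx0 : 0 < x := by linarith
  have hlx : 0 < Real.log x := Real.log_pos (by linarith)
  have h1 : roughUpTo x y = Finset.Icc 1 ⌊x⌋₊ := by
    classical
    refine Finset.filter_true_of_mem fun n _ p hp _ => ?_
    exact hy2.trans_le (by exact_mod_cast hp.two_le)
  rw [eulerW_of_lt_two hy2, mul_one, roughCount, h1, Nat.card_Icc, Nat.add_sub_cancel]
  have h2 : |((⌊x⌋₊ : ℕ) : ℝ) - x| ≤ 1 := by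
    rw [abs_le]
    constructor <;> linarith [Nat.floor_le hx0.le, Nat.lt_floor_add_one x]
  refine h2.trans ?_
  have h3 := Real.pow_div_factorial_le_exp (Real.log x) hlx.le 3
  rw [Real.exp_log hx0, show ((Nat.factorial 3 : ℕ) : ℝ) = 6 by norm_num [Nat.factorial]] at h3
  calc (1 : ℝ) = 6 / l ^ 3 * (Real.log x ^ 3 / 6 * (l / Real.log x) ^ 3) := by field_simp
    _ ≤ 6 / l ^ 3 * (x * (Real.log y / Real.log x) ^ 3) := by gcongr

/-- For `y ≤ x < y⁴` the upper bound sieve suffices. -/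
lemma abs_roughCount_sub_le_of_lt_pow {C x y : ℝ} (hC : 0 ≤ C)
    (hCb : roughCount x y ≤ C * (x * eulerW y)) (hy : 1 < y) (hyx : y ≤ x) (hx : x < y ^ 4) :
    |roughCount x y - x * eulerW y|
      ≤ 64 * (C + 1) * (x * eulerW y * (Real.log y / Real.log x) ^ 3) := by
  have hx0 : 0 < x := by linarith
  have hlx : 0 < Real.log x := Real.log_pos (by linarith)
  have hW := eulerW_pos y
  have h3 : 0 < x * eulerW y := by positivity
  have h2 : |roughCount x y - x * eulerW y| ≤ (C + 1) * (x * eulerW y) := by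
    have h4 := roughCount_nonneg x y
    have h5 : 0 ≤ C * (x * eulerW y) := by positivity
    rw [abs_le, add_mul, one_mul]
    constructor <;> linarith
  refine h2.trans ?_
  have h3 : 1 / 4 ≤ Real.log y / Real.log x := by
    rw [div_le_div_iff₀ (by norm_num) hlx, one_mul]
    have := Real.log_le_log hx0 hx.le
    rw [Real.log_pow] at this
    push_cast at this
    linarith
  calc (C + 1) * (x * eulerW y) = 64 * (C + 1) * (x * eulerW y * (1 / 4) ^ 3) := by ring
    _ ≤ _ := by gcongr

/-- The fundamental lemma: `Φ(x, y) = x W(y) (1 + O((log y / log x)³))` uniformly for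
`2 ≤ y ≤ x`. -/
lemma exists_abs_roughCount_sub_le :
    ∃ A : ℝ, 0 < A ∧ ∀ x y : ℝ, 2 ≤ y → y ≤ x →
      |roughCount x y - x * eulerW y| ≤ A * (x * eulerW y * (Real.log y / Real.log x) ^ 3) := by
  obtain ⟨C, hC, hCb⟩ := exists_roughCount_le
  obtain ⟨c, hc, hcb⟩ := exists_le_eulerW_mul_log
  have hl2 : 0 < Real.log 2 := Real.log_pos one_lt_two
  -- `s ≥ 16 / c²` makes the factor `8 (s / c)² / s³` of the induction step at most `1 / 2`
  obtain ⟨s, hs⟩ := exists_nat_ge (16 / c ^ 2 + 2)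
  obtain ⟨N, hN⟩ := exists_nat_ge (Real.exp (2 * (s + 1)))
  have hs16 : (0 : ℝ) < 16 / c ^ 2 := by positivity
  have hs0 : (2 : ℝ) < s := by linarith
  have hs1 : 1 ≤ s := by exact_mod_cast (show (1 : ℝ) ≤ s by linarith)
  set l := Real.log 2 / s with hl
  have hl0 : 0 < l := by positivity
  set M := 6 * (C + 1) * (s / c) ^ (N + 1) with hM
  -- the three summands serve `y < 2`, then `x < y⁴`, then the induction step
  set A := 6 / l ^ 3 + 64 * (C + 1) + 2 * M with hA
  have hM0 : 0 < M := by positivity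
  have hl3 : 0 < 6 / l ^ 3 := by positivity
  have hA1 : 6 / l ^ 3 ≤ A := by rw [hA]; linarith
  have hA2 : 64 * (C + 1) ≤ A := by rw [hA]; linarith
  have hA3 : 2 * M ≤ A := by rw [hA]; linarith
  have hA0 : 0 < A := by linarith
  clear_value A M l
  have hpos : ∀ x y : ℝ, 1 < y → y ≤ x →
      0 ≤ x * eulerW y * (Real.log y / Real.log x) ^ 3 := fun x y hy hyx =>
    mul_nonneg (mul_nonneg (by linarith) (eulerW_pos y).le)
      (pow_nonneg (div_nonneg (Real.log_nonneg hy.le) (Real.log_nonneg (by linarith))) 3)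
  have key : ∀ j : ℕ, ∀ y : ℝ, 1 < y → l ≤ Real.log y → Real.log y < s ^ j * Real.log 2 →
      ∀ x : ℝ, y ≤ x →
      |roughCount x y - x * eulerW y| ≤ A * (x * eulerW y * (Real.log y / Real.log x) ^ 3) := by
    intro j
    induction j with
    | zero =>
      intro y hy hly hly2 x hyx
      rw [pow_zero, one_mul, Real.log_lt_log_iff (by linarith) two_pos] at hly2
      exact (abs_roughCount_sub_le_of_lt_two hl0 hly hy hly2 hyx).trans
        (mul_le_mul_of_nonneg_right hA1 (hpos x y hy hyx))
    | succ j ih =>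
      intro y hy hly hlj x hyx
      by_cases hj : Real.log y < s ^ j * Real.log 2
      · exact ih y hy hly hj x hyx
      have hly0 : 0 < Real.log y := by linarith
      have hy2 : 2 ≤ y := by
        rw [← Real.log_le_log_iff two_pos (by linarith)]
        refine le_trans ?_ (not_lt.1 hj)
        exact le_mul_of_one_le_left hl2.le (one_le_pow₀ (by linarith))
      have hW := eulerW_pos y
      by_cases hx4 : y ^ 4 ≤ x
      · set y₁ := Real.exp (Real.log y / s) with hy₁
        have hly₁ : Real.log y₁ = Real.log y / s := Real.log_exp _
        have h1y₁ : 1 < y₁ := Real.one_lt_exp_iff.2 (by positivity)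
        have hl2y : Real.log 2 ≤ Real.log y := Real.log_le_log two_pos hy2
        have hIH := ih y₁ h1y₁ (by rw [hly₁, hl]; gcongr)
          (by rw [hly₁, div_lt_iff₀ (by linarith)]; rw [pow_succ] at hlj; linarith)
        have hstep := abs_roughCount_sub_le_step (x := x) (y := y) (N := N) hs1 hA0.le hC.le hCb
          hy2 hx4 h1y₁ (by rw [hly₁]; field_simp) hN hIH
        have hV : eulerW y₁ / eulerW y ≤ s / c := by
          have h1 := eulerW_mul_log_le_one h1y₁.le
          have h2 := hcb y hy2
          rw [hly₁, ← mul_div_assoc, div_le_one (by linarith)] at h1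
          rw [div_le_div_iff₀ hW hc]
          have h3 : eulerW y₁ * c ≤ eulerW y₁ * (eulerW y * Real.log y) :=
            mul_le_mul_of_nonneg_left h2 (eulerW_pos _).le
          calc eulerW y₁ * c ≤ eulerW y₁ * (eulerW y * Real.log y) := h3
            _ = eulerW y₁ * Real.log y * eulerW y := by ring
            _ ≤ s * eulerW y := mul_le_mul_of_nonneg_right h1 hW.le
        have hV0 : 0 ≤ eulerW y₁ / eulerW y := div_nonneg (eulerW_pos _).le hW.le
        refine hstep.trans (mul_le_mul_of_nonneg_right ?_ (hpos x y hy hyx))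
        have h1 : 8 * A / s ^ 3 * (eulerW y₁ / eulerW y) ^ 2 ≤ A / 2 :=
          calc 8 * A / s ^ 3 * (eulerW y₁ / eulerW y) ^ 2 ≤ 8 * A / s ^ 3 * (s / c) ^ 2 := by
                gcongr
            _ = 16 / c ^ 2 * (A / 2) / s := by field_simp; ring
            _ ≤ A / 2 := by
                rw [div_le_iff₀ (by linarith)]
                rw [mul_comm]
                exact mul_le_mul_of_nonneg_left (by linarith) (by linarith)
        have h2 : 6 * (C + 1) * (eulerW y₁ / eulerW y) ^ (N + 1) ≤ M := by
          rw [hM]; gcongr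
        linarith
      · exact (abs_roughCount_sub_le_of_lt_pow hC.le (hCb x y (by linarith) hyx) hy hyx
          (not_le.1 hx4)).trans (mul_le_mul_of_nonneg_right hA2 (hpos x y hy hyx))
  refine ⟨A, hA0, fun x y hy hyx => ?_⟩
  obtain ⟨j, hj⟩ := pow_unbounded_of_one_lt (Real.log y / Real.log 2)
    (show (1 : ℝ) < s by linarith)
  have hl2y : Real.log 2 ≤ Real.log y := Real.log_le_log two_pos hy
  refine key j y (by linarith) ?_ ((div_lt_iff₀ hl2).1 hj) x hyx
  rw [hl, div_le_iff₀ (by linarith)]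
  exact hl2y.trans (le_mul_of_one_le_right (by linarith) (by linarith))

/-! ### Decomposition of an integer with respect to the sieve set -/

lemma Admissible.prime_le {θ : ℕ → WithTop ℝ} (hθ : Admissible θ) {m p : ℕ} (hm : 0 < m)
    (hp : p.Prime) (hpm : p ∣ m) : ((p : ℝ) : WithTop ℝ) ≤ θ m := by
  have h2 : 2 ≤ m := hp.two_le.trans (Nat.le_of_dvd hm hpm)
  refine le_trans ?_ (hθ.2 m h2)
  rw [WithTop.coe_le_coe, Nat.cast_le]
  exact (Finset.le_sup (f := id) (Nat.mem_primeFactors.2 ⟨hp, hpm, hm.ne'⟩)).trans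
    (le_max_right _ _)

lemma Admissible.two_le {θ : ℕ → WithTop ℝ} (hθ : Admissible θ) {m : ℕ} (hm : 0 < m) :
    ((2 : ℝ) : WithTop ℝ) ≤ θ m := by
  rcases Nat.eq_or_lt_of_le (Nat.succ_le_of_lt hm) with h | h
  · rw [← h]; exact hθ.1
  · have h1 : m ≠ 1 := by omega
    refine le_trans ?_ (hθ.prime_le hm (Nat.minFac_prime h1) (Nat.minFac_dvd m))
    rw [WithTop.coe_le_coe]
    exact_mod_cast (Nat.minFac_prime h1).two_le

lemma factorization_partBelow (n p q : ℕ) :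
    (partBelow n p).factorization q = if q < p then n.factorization q else 0 := by
  have h : partBelow n p = (n.factorization.filter (· < p)).prod (· ^ ·) := by
    rw [Finsupp.prod, Finsupp.support_filter, Nat.support_factorization, partBelow]
    refine Finset.prod_congr rfl fun q hq => ?_
    rw [Finsupp.filter_apply_pos (fun x => x < p) _ (Finset.mem_filter.1 hq).2]
  rw [h, Nat.prod_pow_factorization_eq_self, Finsupp.filter_apply]
  intro q hq
  rw [Finsupp.support_filter, Finset.mem_filter, Nat.support_factorization] at hq
  exact Nat.prime_of_mem_primeFactors hq.1

lemma partBelow_ne_zero (n p : ℕ) : partBelow n p ≠ 0 :=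
  Finset.prod_ne_zero_iff.2 fun _ hq =>
    pow_ne_zero _ (Nat.prime_of_mem_primeFactors (Finset.mem_filter.1 hq).1).ne_zero

lemma partBelow_dvd {n : ℕ} (hn : n ≠ 0) (p : ℕ) : partBelow n p ∣ n := by
  rw [← Nat.factorization_le_iff_dvd (partBelow_ne_zero n p) hn]
  intro q
  rw [factorization_partBelow]
  split_ifs <;> simp

lemma mem_primeFactors_partBelow {n p q : ℕ} :
    q ∈ (partBelow n p).primeFactors ↔ q ∈ n.primeFactors ∧ q < p := by
  rw [← Nat.support_factorization, ← Nat.support_factorization, Finsupp.mem_support_iff,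
    Finsupp.mem_support_iff, factorization_partBelow]
  split_ifs with h <;> simp [h]

lemma partBelow_partBelow {n p q : ℕ} (h : q ≤ p) :
    partBelow (partBelow n p) q = partBelow n q := by
  refine Nat.eq_of_factorization_eq (partBelow_ne_zero _ _) (partBelow_ne_zero _ _) fun r => ?_
  simp only [factorization_partBelow]
  split_ifs with h1 h2
  · rfl
  · omega
  · rfl

/-- An integer outside the sieve set has a divisor `m` in the sieve set whose cofactor is nontrivial
and composed of primes exceeding `θ(m)`: stop at the first prime that violates the condition. -/
lemma exists_mul_eq_of_notMem {θ : ℕ → WithTop ℝ} {n : ℕ} (hn : 0 < n) (h : n ∉ sieveSet θ) :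
    ∃ m r : ℕ, m * r = n ∧ m ∈ sieveSet θ ∧ r ≠ 1 ∧
      ∀ p : ℕ, p.Prime → p ∣ r → θ m < ((p : ℝ) : WithTop ℝ) := by
  classical
  have hex : ∃ p : ℕ, p ∈ n.primeFactors ∧ ¬ ((p : ℝ) : WithTop ℝ) ≤ θ (partBelow n p) := by
    by_contra! hcon
    exact h ⟨hn, hcon⟩
  obtain ⟨hp, hpθ⟩ := Nat.find_spec hex
  have hmin : ∀ {q}, q < Nat.find hex → ¬ (q ∈ n.primeFactors ∧
    ¬ ((q : ℝ) : WithTop ℝ) ≤ θ (partBelow n q)) := fun {q} hq => Nat.find_min hex hq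
  set p := Nat.find hex with hpdef
  obtain ⟨r, hr⟩ := partBelow_dvd hn.ne' p
  have hr0 : r ≠ 0 := by rintro rfl; omega
  have hpr : ∀ q : ℕ, q.Prime → q ∣ r → p ≤ q := by
    intro q hq hqr
    by_contra hlt
    have h1 : n.factorization q = (partBelow n p).factorization q + r.factorization q := by
      conv_lhs => rw [hr, Nat.factorization_mul (partBelow_ne_zero _ _) hr0]
      rfl
    rw [factorization_partBelow, if_pos (not_le.1 hlt)] at h1
    have := hq.factorization_pos_of_dvd hr0 hqr
    omega
  refine ⟨partBelow n p, r, hr.symm, ⟨Nat.pos_of_ne_zero (partBelow_ne_zero _ _), ?_⟩, ?_, ?_⟩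
  · intro q hq
    rw [mem_primeFactors_partBelow] at hq
    rw [partBelow_partBelow hq.2.le]
    by_contra hcon
    exact hmin hq.2 ⟨hq.1, hcon⟩
  · rintro rfl
    rw [mul_one] at hr
    have : p ∈ (partBelow n p).primeFactors := by rw [← hr]; exact hp
    exact lt_irrefl _ (mem_primeFactors_partBelow.1 this).2
  · intro q hq hqr
    refine (not_le.1 hpθ).trans_le ?_
    rw [WithTop.coe_le_coe, Nat.cast_le]
    exact hpr q hq hqr

/-- Uniqueness of the decomposition, under an ordering assumption that is no loss of generality. -/
lemma eq_of_mul_eq_mul_of_le {θ : ℕ → WithTop ℝ} (hθ : Admissible θ) {m m' r r' : ℕ}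
    (hm : 0 < m) (hm' : m' ∈ sieveSet θ) (hr : 0 < r) (hr' : 0 < r')
    (h : ∀ p : ℕ, p.Prime → p ∣ r → θ m < ((p : ℝ) : WithTop ℝ))
    (h' : ∀ p : ℕ, p.Prime → p ∣ r' → θ m' < ((p : ℝ) : WithTop ℝ))
    (heq : m * r = m' * r') (hle : θ m ≤ θ m') : m = m' := by
  classical
  have hsmall : ∀ q : ℕ, q.Prime → ((q : ℝ) : WithTop ℝ) ≤ θ m →
      m.factorization q = m'.factorization q := by
    intro q hq hqm
    have h1 := congrArg (fun n => n.factorization q) heq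
    simp only [Nat.factorization_mul hm.ne' hr.ne', Nat.factorization_mul hm'.1.ne' hr'.ne',
      Finsupp.add_apply] at h1
    rw [Nat.factorization_eq_zero_of_not_dvd fun hd => (h q hq hd).not_ge hqm,
      Nat.factorization_eq_zero_of_not_dvd fun hd => (h' q hq hd).not_ge (hqm.trans hle)] at h1
    exact h1
  have hlarge : ∀ q : ℕ, q.Prime → θ m < ((q : ℝ) : WithTop ℝ) → m.factorization q = 0 :=
    fun q hq hqm => Nat.factorization_eq_zero_of_not_dvd fun hd =>
      (hθ.prime_le hm hq hd).not_gt hqm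
  have hnp : ∀ q : ℕ, ¬ q.Prime → m.factorization q = m'.factorization q := fun q hq => by
    rw [Nat.factorization_eq_zero_of_not_prime _ hq, Nat.factorization_eq_zero_of_not_prime _ hq]
  by_cases hex : ∃ p : ℕ, p ∈ m'.primeFactors ∧ θ m < ((p : ℝ) : WithTop ℝ)
  · obtain ⟨hp, hpθ⟩ := Nat.find_spec hex
    have hmin : ∀ {q}, q < Nat.find hex → ¬ (q ∈ m'.primeFactors ∧
      θ m < ((q : ℝ) : WithTop ℝ)) := fun {q} hq => Nat.find_min hex hq
    set p := Nat.find hex with hpdef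
    -- the part of `m'` below its first prime exceeding `θ(m)` is `m`, so that prime is not admitted
    have hpart : partBelow m' p = m := by
      refine Nat.eq_of_factorization_eq (partBelow_ne_zero _ _) hm.ne' fun q => ?_
      rw [factorization_partBelow]
      by_cases hq : q.Prime
      · split_ifs with hqp
        · rcases le_or_gt ((q : ℝ) : WithTop ℝ) (θ m) with hqm | hqm
          · exact (hsmall q hq hqm).symm
          · rw [hlarge q hq hqm]
            refine Nat.factorization_eq_zero_of_not_dvd fun hd => hmin hqp ⟨?_, hqm⟩
            exact Nat.mem_primeFactors.2 ⟨hq, hd, hm'.1.ne'⟩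
        · refine (hlarge q hq (hpθ.trans_le ?_)).symm
          rw [WithTop.coe_le_coe, Nat.cast_le]
          exact not_lt.1 hqp
      · rw [Nat.factorization_eq_zero_of_not_prime _ hq,
          Nat.factorization_eq_zero_of_not_prime _ hq, ite_self]
    exact absurd (hpart ▸ hm'.2 p hp) hpθ.not_ge
  · refine Nat.eq_of_factorization_eq hm.ne' hm'.1.ne' fun q => ?_
    by_cases hq : q.Prime
    · rcases le_or_gt ((q : ℝ) : WithTop ℝ) (θ m) with hqm | hqm
      · exact hsmall q hq hqm
      · rw [hlarge q hq hqm, Nat.factorization_eq_zero_of_not_dvd fun hd =>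
          hex ⟨q, Nat.mem_primeFactors.2 ⟨hq, hd, hm'.1.ne'⟩, hqm⟩]
    · exact hnp q hq

lemma eq_of_mul_eq_mul {θ : ℕ → WithTop ℝ} (hθ : Admissible θ) {m m' r r' : ℕ}
    (hm : m ∈ sieveSet θ) (hm' : m' ∈ sieveSet θ) (hr : 0 < r) (hr' : 0 < r')
    (h : ∀ p : ℕ, p.Prime → p ∣ r → θ m < ((p : ℝ) : WithTop ℝ))
    (h' : ∀ p : ℕ, p.Prime → p ∣ r' → θ m' < ((p : ℝ) : WithTop ℝ))
    (heq : m * r = m' * r') : m = m' := by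
  rcases le_total (θ m) (θ m') with hle | hle
  · exact eq_of_mul_eq_mul_of_le hθ hm.1 hm' hr hr' h h' heq hle
  · exact (eq_of_mul_eq_mul_of_le hθ hm'.1 hm hr' hr h' h heq.symm hle).symm

open Classical in
/-- The integers `1 < r ≤ x` all of whose prime factors exceed `y ∈ ℝ ∪ {∞}`. -/
noncomputable def cofactors (x : ℝ) (y : WithTop ℝ) : Finset ℕ :=
  {r ∈ Finset.Icc 1 ⌊x⌋₊ | r ≠ 1 ∧ ∀ p : ℕ, p.Prime → p ∣ r → y < ((p : ℝ) : WithTop ℝ)}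

lemma mem_cofactors {x : ℝ} {y : WithTop ℝ} {r : ℕ} :
    r ∈ cofactors x y ↔ 0 < r ∧ (r : ℝ) ≤ x ∧ r ≠ 1 ∧
      ∀ p : ℕ, p.Prime → p ∣ r → y < ((p : ℝ) : WithTop ℝ) := by
  classical
  rw [cofactors, Finset.mem_filter, Finset.mem_Icc, and_assoc]
  constructor
  · rintro ⟨h1, h2, h3⟩
    exact ⟨h1, (Nat.le_floor_iff' (by omega)).1 h2, h3⟩
  · rintro ⟨h1, h2, h3⟩
    exact ⟨h1, (Nat.le_floor_iff' (by omega)).2 h2, h3⟩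

/-- No cofactor exists unless `y < x`. -/
lemma cofactors_eq_empty {x : ℝ} {y : WithTop ℝ} (h : (x : WithTop ℝ) ≤ y) :
    cofactors x y = ∅ := by
  refine Finset.eq_empty_of_forall_notMem fun r hr => ?_
  rw [mem_cofactors] at hr
  have h1 := hr.2.2.2 _ (Nat.minFac_prime hr.2.2.1) (Nat.minFac_dvd r)
  have h2 := h.trans_lt h1
  rw [WithTop.coe_lt_coe] at h2
  have h3 : (r.minFac : ℝ) ≤ r := by exact_mod_cast Nat.minFac_le hr.1
  linarith [hr.2.1]

lemma card_cofactors_coe {x y : ℝ} (hx : 1 ≤ x) :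
    ((cofactors x (y : WithTop ℝ)).card : ℝ) = roughCount x y - 1 := by
  have h : cofactors x (y : WithTop ℝ) = (roughUpTo x y).erase 1 := by
    ext r
    simp only [mem_cofactors, Finset.mem_erase, mem_roughUpTo, WithTop.coe_lt_coe]
    tauto
  have h1 : 1 ∈ roughUpTo x y := mem_roughUpTo.2 ⟨one_pos, by exact_mod_cast hx, fun p hp h =>
    absurd (Nat.dvd_one.1 h) hp.ne_one⟩
  rw [h, roughCount, Finset.card_erase_of_mem h1, Nat.cast_pred (Finset.card_pos.2 ⟨1, h1⟩)]

open Classical in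
/-- Counting the multiples of `2^k` outside the sieve set by their divisor `m` in the sieve set;
the cofactor is odd, so that `2^k` divides `m`. -/
lemma card_notMem_sieveSet {θ : ℕ → WithTop ℝ} (hθ : Admissible θ) (k : ℕ) (x : ℝ) :
    ((Finset.Icc 1 ⌊x⌋₊).filter fun n => 2 ^ k ∣ n ∧ n ∉ sieveSet θ).card
      = ∑ m ∈ (Finset.Icc 1 ⌊x⌋₊).filter (fun n => 2 ^ k ∣ n ∧ n ∈ sieveSet θ),
          (cofactors (x / m) (θ m)).card := by
  have hodd : ∀ {m r : ℕ}, 0 < m →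
      (∀ p : ℕ, p.Prime → p ∣ r → θ m < ((p : ℝ) : WithTop ℝ)) → (2 ^ k).Coprime r := by
    intro m r hm hr
    refine Nat.Coprime.pow_left _ ((Nat.Prime.coprime_iff_not_dvd Nat.prime_two).2 fun h => ?_)
    have h1 := (hθ.two_le hm).trans_lt (hr 2 Nat.prime_two h)
    rw [WithTop.coe_lt_coe] at h1
    norm_num at h1
  have hset : ((Finset.Icc 1 ⌊x⌋₊).filter fun n => 2 ^ k ∣ n ∧ n ∉ sieveSet θ)
      = ((Finset.Icc 1 ⌊x⌋₊).filter (fun n => 2 ^ k ∣ n ∧ n ∈ sieveSet θ)).biUnion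
        fun m => (cofactors (x / m) (θ m)).image fun r => m * r := by
    ext n
    simp only [Finset.mem_filter, Finset.mem_Icc, Finset.mem_biUnion, Finset.mem_image]
    constructor
    · rintro ⟨⟨hn, hnx⟩, hk, hnB⟩
      obtain ⟨m, r, rfl, hm, hr1, hr⟩ := exists_mul_eq_of_notMem hn hnB
      have hm0 := hm.1
      have hr0 : 0 < r := Nat.pos_of_mul_pos_left hn
      refine ⟨m, ⟨⟨hm0, (Nat.le_mul_of_pos_right m hr0).trans hnx⟩,
        (hodd hm0 hr).dvd_of_dvd_mul_right hk, hm⟩, r, ?_, rfl⟩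
      rw [mem_cofactors, le_div_iff₀ (by exact_mod_cast hm0)]
      refine ⟨hr0, ?_, hr1, hr⟩
      have := (Nat.le_floor_iff' (by omega)).1 hnx
      push_cast at this
      linarith
    · rintro ⟨m, ⟨⟨hm0, hmx⟩, hk, hm⟩, r, hr, rfl⟩
      rw [mem_cofactors, le_div_iff₀ (by exact_mod_cast hm0)] at hr
      obtain ⟨hr0, hrx, hr1, hr⟩ := hr
      have hpos : 0 < m * r := Nat.mul_pos hm0 hr0
      refine ⟨⟨hpos, (Nat.le_floor_iff' hpos.ne').2 ?_⟩, hk.mul_right _, fun hB => hr1 ?_⟩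
      · push_cast
        linarith
      · -- `m r = (m r) · 1` would be a second decomposition
        have h1 := eq_of_mul_eq_mul hθ hm hB hr0 one_pos hr
          (fun p hp h => absurd (Nat.dvd_one.1 h) hp.ne_one) (mul_one _).symm
        exact Nat.eq_of_mul_eq_mul_left hm0 (by rw [mul_one]; exact h1.symm)
  rw [hset, Finset.card_biUnion]
  · refine Finset.sum_congr rfl fun m hm => Finset.card_image_of_injective _ fun a b hab => ?_
    exact Nat.eq_of_mul_eq_mul_left (Finset.mem_Icc.1 (Finset.mem_filter.1 hm).1).1 hab
  · intro m hm m' hm' hne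
    rw [Function.onFun, Finset.disjoint_left]
    intro n hn hn'
    obtain ⟨r, hr, rfl⟩ := Finset.mem_image.1 hn
    obtain ⟨r', hr', heq⟩ := Finset.mem_image.1 hn'
    rw [mem_cofactors] at hr hr'
    exact hne (eq_of_mul_eq_mul hθ (Finset.mem_filter.1 hm).2.2 (Finset.mem_filter.1 hm').2.2
      hr.1 hr'.1 hr.2.2.2 hr'.2.2.2 heq.symm)

/-! ### The Euler product over an extended real bound -/

lemma eulerProduct_coe (y : ℝ) : eulerProduct (y : WithTop ℝ) = eulerW y := by
  have h : ∀ p : ℕ, (p.Prime ∧ ((p : ℝ) : WithTop ℝ) ≤ (y : WithTop ℝ)) ↔ p ∈ primesUpTo y := by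
    intro p
    rw [mem_primesUpTo, WithTop.coe_le_coe]
  rw [eulerProduct, eulerW, ← Finset.tprod_subtype]
  exact (Equiv.subtypeEquivRight h).tprod_eq
    (fun p : {p // p ∈ primesUpTo y} => 1 - 1 / ((p : ℕ) : ℝ))

lemma eulerProduct_top : eulerProduct ⊤ = 0 := by
  have hf0 : ∀ p : {p : ℕ // p.Prime ∧ ((p : ℝ) : WithTop ℝ) ≤ ⊤}, 0 ≤ 1 - 1 / ((p : ℕ) : ℝ) :=
    fun p => (one_sub_one_div_prime_pos p.2.1).le
  have hf1 : ∀ p : {p : ℕ // p.Prime ∧ ((p : ℝ) : WithTop ℝ) ≤ ⊤}, 1 - 1 / ((p : ℕ) : ℝ) ≤ 1 :=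
    fun p => by
      have : (0 : ℝ) ≤ 1 / ((p : ℕ) : ℝ) := by positivity
      linarith
  refine HasProd.tprod_eq ?_
  rw [HasProd, SummationFilter.unconditional_filter]
  refine tendsto_atTop_isGLB (fun s t hst => ?_) ⟨?_, fun b hb => ?_⟩
  · rw [← Finset.prod_sdiff hst]
    exact mul_le_of_le_one_left (Finset.prod_nonneg fun p _ => hf0 p)
      (Finset.prod_le_one (fun p _ => hf0 p) fun p _ => hf1 p)
  · rintro _ ⟨s, rfl⟩
    exact Finset.prod_nonneg fun p _ => hf0 p
  · -- every lower bound is at most `W(y) ≤ 1 / log y` for all `y`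
    have h1 : ∀ t : ℝ, 0 < t → b ≤ 1 / t := by
      intro t ht
      have h2 : b ≤ eulerW (Real.exp t) := by
        refine hb ⟨(primesUpTo (Real.exp t)).attach.map
          ⟨fun p => ⟨p.1, (mem_primesUpTo.1 p.2).1, le_top⟩,
            fun p q hpq => Subtype.ext (by simpa using hpq)⟩, ?_⟩
        rw [eulerW, ← Finset.prod_attach]
        exact Finset.prod_map _ _ _
      have h3 := eulerW_mul_log_le_one (y := Real.exp t) (Real.one_le_exp ht.le)
      rw [Real.log_exp] at h3
      exact h2.trans ((le_div_iff₀ ht).2 h3)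
    by_contra! hpos
    have h4 := h1 (2 / b) (by positivity)
    rw [one_div_div] at h4
    linarith

lemma eulerProduct_nonneg (y : WithTop ℝ) : 0 ≤ eulerProduct y := by
  induction y using WithTop.recTopCoe with
  | top => exact eulerProduct_top.ge
  | coe y => rw [eulerProduct_coe]; exact (eulerW_pos y).le

/-! ### Regularly growing functions -/

/-- The regularity of the functions `n ↦ n^a` (with `β = 0`) and `n ↦ (log 2n)^a` (with `β = 1/a`)
on which the asymptotic for `B(x)` depends. -/
structure RegularGrowth (g : ℕ → ℝ) (β K : ℝ) : Prop where
  beta_nonneg : 0 ≤ β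
  beta_lt_one : β < 1
  const_pos : 0 < K
  pos : ∀ m : ℕ, 1 ≤ m → 0 < g m
  mono : ∀ m n : ℕ, 1 ≤ m → m ≤ n → g m ≤ g n
  log_le : ∀ m : ℕ, 1 ≤ m → Real.log m ≤ K * g m
  sum_le : ∀ N : ℕ, 1 ≤ N → ∑ m ∈ Finset.Icc 1 N, g m / m ≤ K * g N ^ (1 + β)
  tail_le : ∀ N : ℕ, 1 ≤ N → ∀ M : ℕ,
    ∑ m ∈ Finset.Icc N M, 1 / ((m : ℝ) * g m) ≤ K * g N ^ (-(1 - β))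

namespace RegularGrowth

variable {g : ℕ → ℝ} {β K : ℝ}

lemma sum_le_of_le (hg : RegularGrowth g β K) {s : Finset ℕ} {Y : ℝ} (hY : 0 ≤ Y)
    (hs : ∀ m ∈ s, 1 ≤ m ∧ g m ≤ Y) : ∑ m ∈ s, g m / m ≤ K * Y ^ (1 + β) := by
  have hK := hg.const_pos
  have hβ := hg.beta_nonneg
  rcases s.eq_empty_or_nonempty with rfl | hne
  · rw [Finset.sum_empty]
    positivity
  obtain ⟨h1, h2⟩ := hs _ (s.max'_mem hne)
  have h0 := hg.pos _ h1
  calc ∑ m ∈ s, g m / m ≤ ∑ m ∈ Finset.Icc 1 (s.max' hne), g m / m := by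
        refine Finset.sum_le_sum_of_subset_of_nonneg
          (fun m hm => Finset.mem_Icc.2 ⟨(hs m hm).1, s.le_max' m hm⟩) fun m hm _ => ?_
        exact div_nonneg (hg.pos m (Finset.mem_Icc.1 hm).1).le (Nat.cast_nonneg m)
    _ ≤ K * g (s.max' hne) ^ (1 + β) := hg.sum_le _ h1
    _ ≤ K * Y ^ (1 + β) := by gcongr

lemma tail_le_of_le (hg : RegularGrowth g β K) {s : Finset ℕ} {Y : ℝ} (hY : 0 < Y)
    (hs : ∀ m ∈ s, 1 ≤ m ∧ Y ≤ g m) :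
    ∑ m ∈ s, 1 / ((m : ℝ) * g m) ≤ K * Y ^ (-(1 - β)) := by
  have hK := hg.const_pos
  have hβ := hg.beta_lt_one
  rcases s.eq_empty_or_nonempty with rfl | hne
  · rw [Finset.sum_empty]
    positivity
  obtain ⟨h1, h2⟩ := hs _ (s.min'_mem hne)
  calc ∑ m ∈ s, 1 / ((m : ℝ) * g m)
      ≤ ∑ m ∈ Finset.Icc (s.min' hne) (s.max' hne), 1 / ((m : ℝ) * g m) := by
        refine Finset.sum_le_sum_of_subset_of_nonneg
          (fun m hm => Finset.mem_Icc.2 ⟨s.min'_le m hm, s.le_max' m hm⟩) fun m hm _ => ?_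
        have := hg.pos m (h1.trans (Finset.mem_Icc.1 hm).1)
        positivity
    _ ≤ K * g (s.min' hne) ^ (-(1 - β)) := hg.tail_le _ h1 _
    _ ≤ K * Y ^ (-(1 - β)) := mul_le_mul_of_nonneg_left
        (Real.rpow_le_rpow_of_nonpos hY h2 (by linarith)) hK.le

/-- `Σ_j 1 / (j g(2^k j))` tends to `0` as `k → ∞`. -/
lemma exists_pow_sum_le (hg : RegularGrowth g β K) {ε : ℝ} (hε : 0 < ε) :
    ∃ k : ℕ, ∀ s : Finset ℕ, (∀ j ∈ s, 1 ≤ j) →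
      ∑ j ∈ s, 1 / ((j : ℝ) * g (2 ^ k * j)) ≤ ε := by
  classical
  have hK := hg.const_pos
  have hβ := hg.beta_lt_one
  have hlim : Filter.Tendsto (fun Y : ℝ => K * Y ^ (-(1 - β))) Filter.atTop (nhds 0) := by
    simpa using (tendsto_rpow_neg_atTop (show 0 < 1 - β by linarith)).const_mul K
  obtain ⟨Y, hY, hY0⟩ := ((hlim.eventually_le_const (show 0 < ε / 2 by linarith)).and
    (Filter.eventually_gt_atTop 0)).exists
  set J : ℝ := Real.exp (K * Y) with hJ
  have hl2 : 0 < Real.log 2 := Real.log_pos one_lt_two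
  obtain ⟨k, hk⟩ := exists_nat_ge (2 * J * K / (ε * Real.log 2))
  have hgk : 0 < g (2 ^ k) := hg.pos _ Nat.one_le_two_pow
  have hJg : J / g (2 ^ k) ≤ ε / 2 := by
    have h1 := hg.log_le (2 ^ k) Nat.one_le_two_pow
    rw [Nat.cast_pow, Nat.cast_ofNat, Real.log_pow] at h1
    rw [div_le_iff₀ (by positivity)] at hk
    rw [div_le_iff₀ hgk]
    have h2 : 2 * J * K ≤ ε * (K * g (2 ^ k)) := by
      calc 2 * J * K ≤ k * (ε * Real.log 2) := hk
        _ = ε * (k * Real.log 2) := by ring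
        _ ≤ _ := mul_le_mul_of_nonneg_left h1 hε.le
    have h3 : 2 * J * K ≤ (ε * g (2 ^ k)) * K := by linarith
    have := le_of_mul_le_mul_right h3 hK
    linarith
  -- terms with `g(j) ≥ Y` are bounded by the tail, the at most `J` others by `1 / g(2^k)` each
  refine ⟨k, fun s hs => ?_⟩
  have hpos : ∀ j ∈ s, 0 < g (2 ^ k * j) := fun j hj =>
    hg.pos _ (Nat.mul_pos (by positivity) (hs j hj))
  rw [← Finset.sum_filter_add_sum_filter_not s (fun j => Y ≤ g j)]
  have h1 : ∑ j ∈ s with Y ≤ g j, 1 / ((j : ℝ) * g (2 ^ k * j)) ≤ ε / 2 := by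
    refine le_trans (Finset.sum_le_sum fun j hj => ?_) ((hg.tail_le_of_le hY0
      (s := s.filter fun j => Y ≤ g j) fun j hj => ?_).trans hY)
    · rw [Finset.mem_filter] at hj
      have hj0 := hs j hj.1
      have := hg.pos j hj0
      have hj' : (0 : ℝ) < j := by exact_mod_cast hj0
      exact one_div_le_one_div_of_le (by positivity) (mul_le_mul_of_nonneg_left
        (hg.mono _ _ hj0 (Nat.le_mul_of_pos_left j (by positivity))) hj'.le)
    · rw [Finset.mem_filter] at hj
      exact ⟨hs j hj.1, hj.2⟩
  have h2 : ∑ j ∈ s with ¬ Y ≤ g j, 1 / ((j : ℝ) * g (2 ^ k * j)) ≤ ε / 2 := by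
    calc _ ≤ ∑ j ∈ s with ¬ Y ≤ g j, 1 / g (2 ^ k) := by
          refine Finset.sum_le_sum fun j hj => ?_
          rw [Finset.mem_filter] at hj
          have hj0 := hs j hj.1
          have hj' : (1 : ℝ) ≤ j := by exact_mod_cast hj0
          refine one_div_le_one_div_of_le hgk ((hg.mono _ _ Nat.one_le_two_pow
            (Nat.le_mul_of_pos_right _ hj0)).trans ?_)
          exact le_mul_of_one_le_left (hpos j hj.1).le hj'
      _ = ((s.filter fun j => ¬ Y ≤ g j).card : ℝ) / g (2 ^ k) := by
          rw [Finset.sum_const, nsmul_eq_mul, mul_one_div]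
      _ ≤ J / g (2 ^ k) := by
          refine div_le_div_of_nonneg_right ?_ hgk.le
          have hsub : (s.filter fun j => ¬ Y ≤ g j) ⊆ Finset.Icc 1 ⌊J⌋₊ := by
            intro j hj
            rw [Finset.mem_filter, not_le] at hj
            have hj0 := hs j hj.1
            rw [Finset.mem_Icc, Nat.le_floor_iff' (by omega)]
            refine ⟨hj0, ?_⟩
            rw [hJ, ← Real.log_le_iff_le_exp (by exact_mod_cast hj0)]
            exact (hg.log_le j hj0).trans (mul_le_mul_of_nonneg_left hj.2.le hK.le)
          have hcard := Finset.card_le_card hsub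
          rw [Nat.card_Icc, Nat.add_sub_cancel] at hcard
          exact (Nat.cast_le.2 hcard).trans (Nat.floor_le (Real.exp_pos _).le)
      _ ≤ ε / 2 := hJg
  linarith

end RegularGrowth

/-! ### The series `L` -/

/-- The `n`-th term of the series defining `L`. -/
noncomputable def sieveTerm (θ : ℕ → WithTop ℝ) (n : ℕ) : ℝ :=
  (sieveSet θ).indicator (fun n => 1 / (n : ℝ) * eulerProduct (θ n)) n

lemma sieveTerm_nonneg (θ : ℕ → WithTop ℝ) (n : ℕ) : 0 ≤ sieveTerm θ n :=
  Set.indicator_nonneg (fun _ _ => mul_nonneg (by positivity) (eulerProduct_nonneg _)) n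

lemma sieveTerm_of_mem {θ : ℕ → WithTop ℝ} {n : ℕ} (h : n ∈ sieveSet θ) :
    sieveTerm θ n = 1 / (n : ℝ) * eulerProduct (θ n) := Set.indicator_of_mem h _

lemma sieveTerm_of_notMem {θ : ℕ → WithTop ℝ} {n : ℕ} (h : n ∉ sieveSet θ) :
    sieveTerm θ n = 0 := Set.indicator_of_notMem h _

lemma eulerW_le_one_div {c t G : ℝ} (hc : 0 < c) (hG : 0 < G) (h : c * G ≤ Real.log t)
    (ht : 2 ≤ t) : eulerW t ≤ 1 / (c * G) := by
  have h0 : 0 < c * G := by positivity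
  rw [le_div_iff₀ h0]
  exact (mul_le_mul_of_nonneg_left h (eulerW_pos t).le).trans
    (eulerW_mul_log_le_one (by linarith))

/-- `c g(m) ≤ log θ(m) ≤ C g(m)` for all `m ≥ 1` at which `θ` is finite. -/
def Comparable (θ : ℕ → WithTop ℝ) (g : ℕ → ℝ) (c C : ℝ) : Prop :=
  ∀ m : ℕ, 1 ≤ m → ∀ t : ℝ, θ m = (t : WithTop ℝ) →
    c * g m ≤ Real.log t ∧ Real.log t ≤ C * g m

variable {θ : ℕ → WithTop ℝ} {g : ℕ → ℝ} {β K c C : ℝ}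

lemma Admissible.two_le_of_eq (hθ : Admissible θ) {m : ℕ} (hm : 0 < m) {t : ℝ}
    (ht : θ m = (t : WithTop ℝ)) : 2 ≤ t := by
  have := hθ.two_le hm
  rwa [ht, WithTop.coe_le_coe] at this

lemma sieveTerm_le (hθ : Admissible θ) (hg : RegularGrowth g β K) (hc : 0 < c)
    (hcmp : Comparable θ g c C) {m : ℕ} (hm : 1 ≤ m) :
    sieveTerm θ m ≤ 1 / c * (1 / ((m : ℝ) * g m)) := by
  have hgm := hg.pos m hm
  by_cases hB : m ∈ sieveSet θ
  · rw [sieveTerm_of_mem hB]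
    by_cases hfin : θ m = ⊤
    · rw [hfin, eulerProduct_top, mul_zero]
      positivity
    · obtain ⟨t, hθm⟩ := WithTop.ne_top_iff_exists.1 hfin
      replace hθm := hθm.symm
      rw [hθm, eulerProduct_coe]
      have h1 := eulerW_le_one_div hc hgm (hcmp m hm t hθm).1 (hθ.two_le_of_eq hm hθm)
      calc 1 / (m : ℝ) * eulerW t ≤ 1 / (m : ℝ) * (1 / (c * g m)) := by gcongr
        _ = _ := by rw [one_div_mul_one_div, one_div_mul_one_div]; congr 1; ring
  · rw [sieveTerm_of_notMem hB]
    positivity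

lemma sieveTerm_zero : sieveTerm θ 0 = 0 :=
  sieveTerm_of_notMem fun h => absurd h.1 (lt_irrefl 0)

lemma summable_sieveTerm (hθ : Admissible θ) (hg : RegularGrowth g β K) (hc : 0 < c)
    (hcmp : Comparable θ g c C) : Summable (sieveTerm θ) := by
  refine summable_of_sum_le (c := 1 / c * (K * g 1 ^ (-(1 - β)))) (sieveTerm_nonneg θ) fun s => ?_
  have h1 : ∑ n ∈ s, sieveTerm θ n = ∑ n ∈ s.erase 0, sieveTerm θ n := by
    symm
    exact Finset.sum_erase _ sieveTerm_zero
  have hs : ∀ m ∈ s.erase 0, 1 ≤ m := fun m hm =>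
    Nat.one_le_iff_ne_zero.2 (Finset.ne_of_mem_erase hm)
  calc ∑ n ∈ s, sieveTerm θ n ≤ ∑ n ∈ s.erase 0, 1 / c * (1 / ((n : ℝ) * g n)) := by
        rw [h1]
        exact Finset.sum_le_sum fun m hm => sieveTerm_le hθ hg hc hcmp (hs m hm)
    _ ≤ 1 / c * (K * g 1 ^ (-(1 - β))) := by
        rw [← Finset.mul_sum]
        exact mul_le_mul_of_nonneg_left (hg.tail_le_of_le (hg.pos 1 le_rfl) fun m hm =>
          ⟨hs m hm, hg.mono 1 m le_rfl (hs m hm)⟩) (by positivity)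

lemma two_pow_mem_sieveSet (hθ : Admissible θ) {k : ℕ} (hk : k ≠ 0) : 2 ^ k ∈ sieveSet θ := by
  refine ⟨by positivity, fun p hp => ?_⟩
  rw [Nat.primeFactors_prime_pow hk Nat.prime_two, Finset.mem_singleton] at hp
  subst hp
  have : partBelow (2 ^ k) 2 = 1 := by
    refine Finset.prod_eq_one fun q hq => ?_
    rw [Finset.mem_filter, Nat.primeFactors_prime_pow hk Nat.prime_two, Finset.mem_singleton] at hq
    omega
  rw [this]
  exact hθ.1

/-- `L > 0`: the powers of `2` lie in the sieve set, and `θ` is finite at the large ones. -/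
lemma sieveL_pos (hθ : Admissible θ) (hs : Summable (sieveTerm θ))
    (hfin : ∀ᶠ n in Filter.atTop, θ n ≠ ⊤) : 0 < sieveL θ := by
  obtain ⟨N, hN⟩ := Filter.eventually_atTop.1 hfin
  have hB := two_pow_mem_sieveSet hθ (Nat.succ_ne_zero N)
  have hfin' : θ (2 ^ (N + 1)) ≠ ⊤ := hN _ ((Nat.lt_two_pow_self).le.trans
    (Nat.pow_le_pow_right two_pos (Nat.le_succ N)))
  obtain ⟨t, ht⟩ := WithTop.ne_top_iff_exists.1 hfin'
  refine hs.tsum_pos (sieveTerm_nonneg θ) (2 ^ (N + 1)) ?_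
  rw [sieveTerm_of_mem hB, ← ht, eulerProduct_coe]
  exact mul_pos (by positivity) (eulerW_pos t)

/-! ### The counting function -/

open Classical in
lemma countB_eq_card (θ : ℕ → WithTop ℝ) (x : ℝ) :
    countB θ x = ((Finset.Icc 1 ⌊x⌋₊).filter fun n => n ∈ sieveSet θ).card := by
  rw [countB, ← Set.ncard_coe_finset]
  congr 1
  ext n
  simp only [Set.mem_ofPred_eq, Finset.coe_filter, Finset.mem_Icc]
  constructor
  · rintro ⟨h1, h2⟩
    exact ⟨⟨h1.1, (Nat.le_floor_iff' h1.1.ne').2 h2⟩, h1⟩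
  · rintro ⟨⟨h1, h2⟩, h3⟩
    exact ⟨h3, (Nat.le_floor_iff' (by omega)).1 h2⟩

open Classical in
/-- Every multiple of `2^k` up to `x` lies in the sieve set or arises from a cofactor. -/
lemma card_add_sum_cofactors (hθ : Admissible θ) (k : ℕ) (x : ℝ) :
    ((Finset.Icc 1 ⌊x⌋₊).filter fun n => 2 ^ k ∣ n ∧ n ∈ sieveSet θ).card
      + ∑ m ∈ (Finset.Icc 1 ⌊x⌋₊).filter (fun n => 2 ^ k ∣ n ∧ n ∈ sieveSet θ),
          (cofactors (x / m) (θ m)).card = ⌊x⌋₊ / 2 ^ k := by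
  rw [← card_notMem_sieveSet hθ k x, ← Finset.filter_filter, ← Finset.filter_filter,
    Finset.card_filter_add_card_filter_not, ← Nat.Ioc_filter_dvd_card_eq_div]
  rfl

/-- A positive proportion of the multiples of a high power of `2` lies in the sieve set. -/
lemma exists_le_countB (hθ : Admissible θ) (hg : RegularGrowth g β K) (hc : 0 < c)
    (hcmp : Comparable θ g c C) :
    ∃ δ : ℝ, 0 < δ ∧ ∀ x : ℝ, 0 ≤ x → δ * x - 2 ≤ countB θ x := by
  classical
  obtain ⟨C₀, hC₀, hC₀b⟩ := exists_roughCount_le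
  obtain ⟨k, hk⟩ := hg.exists_pow_sum_le (ε := c / (2 * C₀)) (by positivity)
  refine ⟨1 / 2 ^ k / 2, by positivity, fun x hx => ?_⟩
  set I := (Finset.Icc 1 ⌊x⌋₊).filter fun n => 2 ^ k ∣ n ∧ n ∈ sieveSet θ with hI
  have hId : ∀ m ∈ I, 1 ≤ m ∧ (m : ℝ) ≤ x ∧ 2 ^ k ∣ m := by
    intro m hm
    rw [hI, Finset.mem_filter, Finset.mem_Icc] at hm
    exact ⟨hm.1.1, (Nat.le_floor_iff' (by omega)).1 hm.1.2, hm.2.1⟩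
  have h1 := card_add_sum_cofactors hθ k x
  rw [← hI] at h1
  have h2 : ∀ m ∈ I, ((cofactors (x / m) (θ m)).card : ℝ)
      ≤ C₀ / c * x * (1 / ((m : ℝ) * g m)) := by
    intro m hm
    obtain ⟨hm1, hmx, -⟩ := hId m hm
    have hgm := hg.pos m hm1
    have hm0 : (0 : ℝ) < m := by exact_mod_cast hm1
    rcases le_or_gt ((x / m : ℝ) : WithTop ℝ) (θ m) with hle | hlt
    · rw [cofactors_eq_empty hle, Finset.card_empty, Nat.cast_zero]
      positivity
    · obtain ⟨t, ht⟩ := WithTop.ne_top_iff_exists.1 (ne_top_of_lt hlt)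
      have ht2 := hθ.two_le_of_eq hm1 ht.symm
      rw [← ht, WithTop.coe_lt_coe] at hlt
      rw [← ht, card_cofactors_coe (by linarith)]
      have h3 := hC₀b (x / m) t (by linarith) hlt.le
      have h4 := eulerW_le_one_div hc hgm (hcmp m hm1 t ht.symm).1 ht2
      calc roughCount (x / m) t - 1 ≤ C₀ * (x / m * eulerW t) := by linarith
        _ ≤ C₀ * (x / m * (1 / (c * g m))) := by gcongr
        _ = _ := by field_simp
  have h3 : ∑ m ∈ I, 1 / ((m : ℝ) * g m) ≤ 1 / 2 ^ k * (c / (2 * C₀)) := by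
    have hinj : Set.InjOn (fun m => m / 2 ^ k) I := by
      intro a ha b hb hab
      rw [← Nat.div_mul_cancel (hId a ha).2.2, ← Nat.div_mul_cancel (hId b hb).2.2]
      exact congrArg (· * 2 ^ k) hab
    have h4 := hk (I.image fun m => m / 2 ^ k) (by
      intro j hj
      obtain ⟨m, hm, rfl⟩ := Finset.mem_image.1 hj
      exact Nat.div_pos (Nat.le_of_dvd (hId m hm).1 (hId m hm).2.2) (by positivity))
    rw [Finset.sum_image hinj] at h4
    refine le_trans (le_of_eq ?_) (mul_le_mul_of_nonneg_left h4 (by positivity))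
    rw [Finset.mul_sum]
    refine Finset.sum_congr rfl fun m hm => ?_
    obtain ⟨j, rfl⟩ := (hId m hm).2.2
    rw [Nat.mul_div_cancel_left _ (by positivity)]
    push_cast
    rw [one_div_mul_one_div]
    congr 1
    ring
  have h4 : (∑ m ∈ I, ((cofactors (x / m) (θ m)).card : ℝ)) ≤ 1 / 2 ^ k / 2 * x := by
    refine (Finset.sum_le_sum h2).trans ?_
    rw [← Finset.mul_sum]
    calc _ ≤ C₀ / c * x * (1 / 2 ^ k * (c / (2 * C₀))) :=
          mul_le_mul_of_nonneg_left h3 (by positivity)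
      _ = _ := by field_simp
  have h5 : x / 2 ^ k - 2 ≤ ((⌊x⌋₊ / 2 ^ k : ℕ) : ℝ) := by
    rw [show ⌊x⌋₊ / 2 ^ k = ⌊x / ((2 ^ k : ℕ) : ℝ)⌋₊ from (Nat.floor_div_natCast x _).symm]
    have := Nat.sub_one_lt_floor (x / ((2 ^ k : ℕ) : ℝ))
    push_cast at this ⊢
    linarith
  have h6 : (I.card : ℝ) ≤ countB θ x := by
    rw [countB_eq_card, Nat.cast_le]
    exact Finset.card_le_card (Finset.monotone_filter_right _ fun n _ h => h.2)
  have h7 : (I.card : ℝ) + ∑ m ∈ I, ((cofactors (x / m) (θ m)).card : ℝ)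
      = ((⌊x⌋₊ / 2 ^ k : ℕ) : ℝ) := by
    rw [← h1]
    push_cast
    rfl
  have h8 : x / 2 ^ k = 1 / 2 ^ k / 2 * x + 1 / 2 ^ k / 2 * x := by ring
  linarith

/-! ### The asymptotic formula -/

/-- The contribution of a single `m` with `θ(m) = t < x/m` to the error term. -/
lemma abs_roughCount_sub_one_sub_le {A X t l κ : ℝ} (hA : 0 ≤ A)
    (hAb : |roughCount X t - X * eulerW t| ≤
      A * (X * eulerW t * (Real.log t / Real.log X) ^ 3))
    (ht : 2 ≤ t) (htX : t < X) (hl : 0 < l) (hlX : l ≤ κ * Real.log X) :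
    |roughCount X t - 1 - X * eulerW t|
      ≤ (A + 2 / Real.log 2) * κ ^ 2 * (X * Real.log t / l ^ 2) := by
  have hl2 : 0 < Real.log 2 := Real.log_pos one_lt_two
  have hX0 : 0 < X := by linarith
  have hlt : 0 < Real.log t := Real.log_pos (by linarith)
  have hlX0 : 0 < Real.log X := Real.log_pos (by linarith)
  have hltX : Real.log t ≤ Real.log X := Real.log_le_log (by linarith) htX.le
  have hWt := eulerW_mul_log_le_one (y := t) (by linarith)
  have hW := eulerW_pos t
  set R := X * Real.log t / Real.log X ^ 2 with hR
  have h1 : |roughCount X t - X * eulerW t| ≤ A * R := by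
    refine hAb.trans (mul_le_mul_of_nonneg_left ?_ hA)
    calc X * eulerW t * (Real.log t / Real.log X) ^ 3
        = R * (eulerW t * Real.log t) * (Real.log t / Real.log X) := by rw [hR]; field_simp
      _ ≤ R * 1 * 1 := by
          have : Real.log t / Real.log X ≤ 1 := (div_le_one hlX0).2 hltX
          gcongr
      _ = R := by ring
  -- the integer `1`, excluded from the cofactors, is absorbed by `(log X)² ≪ X`
  have h2 : 1 ≤ 2 / Real.log 2 * R := by
    have h3 := Real.pow_div_factorial_le_exp (Real.log X) hlX0.le 2
    rw [Real.exp_log hX0, show ((Nat.factorial 2 : ℕ) : ℝ) = 2 by norm_num [Nat.factorial]] at h3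
    have h4 : Real.log 2 ≤ Real.log t := Real.log_le_log two_pos ht
    calc (1 : ℝ) = 2 / Real.log 2 * ((Real.log X ^ 2 / 2) * Real.log 2 / Real.log X ^ 2) := by
          field_simp
      _ ≤ _ := by rw [hR]; gcongr
  have h3 : R ≤ κ ^ 2 * (X * Real.log t / l ^ 2) := by
    have h4 : l ^ 2 ≤ κ ^ 2 * Real.log X ^ 2 := by
      rw [← mul_pow]; exact pow_le_pow_left₀ hl.le hlX 2
    rw [hR, ← mul_div_assoc, div_le_div_iff₀ (by positivity) (by positivity)]
    calc X * Real.log t * l ^ 2 ≤ X * Real.log t * (κ ^ 2 * Real.log X ^ 2) := by gcongr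
      _ = _ := by ring
  have h4 : |roughCount X t - 1 - X * eulerW t| ≤ |roughCount X t - X * eulerW t| + 1 := by
    rw [show roughCount X t - 1 - X * eulerW t = roughCount X t - X * eulerW t - 1 by ring]
    simpa using abs_sub (roughCount X t - X * eulerW t) 1
  calc _ ≤ A * R + 2 / Real.log 2 * R := h4.trans (add_le_add h1 h2)
    _ = (A + 2 / Real.log 2) * R := by ring
    _ ≤ (A + 2 / Real.log 2) * (κ ^ 2 * (X * Real.log t / l ^ 2)) := by gcongr
    _ = _ := by ring

open Classical in
/-- The integers `m ≤ x` of the sieve set with `θ(m) < x/m`, the only ones that can have a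
nontrivial cofactor. -/
noncomputable def activeSet (θ : ℕ → WithTop ℝ) (x : ℝ) : Finset ℕ :=
  {m ∈ Finset.Icc 1 ⌊x⌋₊ | m ∈ sieveSet θ ∧ θ m < ((x / m : ℝ) : WithTop ℝ)}

lemma mem_activeSet {x : ℝ} {m : ℕ} :
    m ∈ activeSet θ x ↔ m ∈ sieveSet θ ∧ (m : ℝ) ≤ x ∧ θ m < ((x / m : ℝ) : WithTop ℝ) := by
  classical
  rw [activeSet, Finset.mem_filter, Finset.mem_Icc]
  constructor
  · rintro ⟨⟨h1, h2⟩, h3, h4⟩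
    exact ⟨h3, (Nat.le_floor_iff' (by omega)).1 h2, h4⟩
  · rintro ⟨h1, h2, h3⟩
    exact ⟨⟨h1.1, (Nat.le_floor_iff' h1.1.ne').2 h2⟩, h1, h3⟩

lemma countB_eq_sub (hθ : Admissible θ) (x : ℝ) :
    (countB θ x : ℝ) = ⌊x⌋₊ - ∑ m ∈ activeSet θ x, ((cofactors (x / m) (θ m)).card : ℝ) := by
  classical
  have h1 := card_add_sum_cofactors hθ 0 x
  simp only [pow_zero, Nat.div_one, one_dvd, true_and] at h1
  rw [← countB_eq_card] at h1
  rw [← h1]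
  push_cast
  rw [eq_sub_iff_add_eq]
  congr 1
  refine Finset.sum_subset (fun m hm => ?_) fun m hm hm' => ?_
  · rw [activeSet, Finset.mem_filter] at hm
    exact Finset.mem_filter.2 ⟨hm.1, hm.2.1⟩
  · rw [Finset.mem_filter] at hm
    rw [cofactors_eq_empty, Finset.card_empty, Nat.cast_zero]
    by_contra hcon
    exact hm' (Finset.mem_filter.2 ⟨hm.1, hm.2, not_le.1 hcon⟩)

/-- The active `m` have `log θ(m) < log (x/m)`, while `log m ≪ g(m) ≪ log θ(m)`; hence
`log x ≪ log (x/m)`. -/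
lemma exists_of_mem_activeSet (hθ : Admissible θ) (hg : RegularGrowth g β K) (hc : 0 < c)
    (hcmp : Comparable θ g c C) {x : ℝ} {m : ℕ} (hm : m ∈ activeSet θ x) :
    1 ≤ m ∧ ∃ t : ℝ, θ m = (t : WithTop ℝ) ∧ 2 ≤ t ∧ t < x / m ∧
      Real.log t ≤ C * g m ∧ c * g m ≤ Real.log x ∧
      Real.log x ≤ (K / c + 1) * Real.log (x / m) := by
  obtain ⟨hB, hmx, hlt⟩ := mem_activeSet.1 hm
  have hm1 : 1 ≤ m := hB.1
  have hm0 : (1 : ℝ) ≤ m := by exact_mod_cast hm1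
  obtain ⟨t, ht⟩ := WithTop.ne_top_iff_exists.1 (ne_top_of_lt hlt)
  replace ht := ht.symm
  have ht2 := hθ.two_le_of_eq hm1 ht
  rw [ht, WithTop.coe_lt_coe] at hlt
  obtain ⟨h1, h2⟩ := hcmp m hm1 t ht
  have hlog : Real.log x = Real.log m + Real.log (x / m) := by
    rw [Real.log_div (by linarith) (by linarith)]; ring
  have h3 : Real.log t ≤ Real.log (x / m) := Real.log_le_log (by linarith) hlt.le
  have h4 : 0 ≤ Real.log m := Real.log_nonneg hm0
  have hK := hg.const_pos
  refine ⟨hm1, t, ht, ht2, hlt, h2, by linarith, ?_⟩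
  have h5 : Real.log m ≤ K / c * Real.log (x / m) :=
    calc Real.log m ≤ K * g m := hg.log_le m hm1
      _ = K / c * (c * g m) := by field_simp
      _ ≤ K / c * Real.log (x / m) := mul_le_mul_of_nonneg_left (h1.trans h3) (by positivity)
  linarith

/-- The fundamental lemma, summed over the active `m`. -/
lemma exists_sum_activeSet_le (hθ : Admissible θ) (hg : RegularGrowth g β K) (hc : 0 < c)
    (hC : 0 < C) (hcmp : Comparable θ g c C) :
    ∃ M : ℝ, 0 < M ∧ ∀ x : ℝ, 2 ≤ x →
      |∑ m ∈ activeSet θ x, ((cofactors (x / m) (θ m)).card : ℝ)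
        - x * ∑ m ∈ activeSet θ x, sieveTerm θ m| ≤ M * (x * Real.log x ^ (-(1 - β))) := by
  obtain ⟨A, hA, hAb⟩ := exists_abs_roughCount_sub_le
  have hl2 : 0 < Real.log 2 := Real.log_pos one_lt_two
  have hK := hg.const_pos
  set κ := K / c + 1 with hκ
  have hκ0 : 0 < κ := by positivity
  set M₁ := (A + 2 / Real.log 2) * κ ^ 2 with hM₁
  have hM₁0 : 0 < M₁ := by positivity
  refine ⟨M₁ * C * (K * (1 / c) ^ (1 + β)), by positivity, fun x hx => ?_⟩
  have hx0 : 0 < x := by linarith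
  have hlx : 0 < Real.log x := Real.log_pos (by linarith)
  have h1 : ∀ m ∈ activeSet θ x, |((cofactors (x / m) (θ m)).card : ℝ) - x * sieveTerm θ m|
      ≤ M₁ * C * (x / Real.log x ^ 2) * (g m / m) := by
    intro m hm
    obtain ⟨hm1, t, ht, ht2, htX, hlt, -, hlX⟩ := exists_of_mem_activeSet hθ hg hc hcmp hm
    have hm0 : (0 : ℝ) < m := by exact_mod_cast hm1
    rw [sieveTerm_of_mem (mem_activeSet.1 hm).1, ht, eulerProduct_coe,
      card_cofactors_coe (by linarith),
      show x * (1 / (m : ℝ) * eulerW t) = x / m * eulerW t by ring]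
    refine (abs_roughCount_sub_one_sub_le hA.le (hAb _ _ ht2 htX.le) ht2 htX hlx hlX).trans ?_
    calc M₁ * (x / m * Real.log t / Real.log x ^ 2)
        ≤ M₁ * (x / m * (C * g m) / Real.log x ^ 2) := by gcongr
      _ = _ := by ring
  have h2 : ∑ m ∈ activeSet θ x, g m / m ≤ K * (Real.log x / c) ^ (1 + β) := by
    refine hg.sum_le_of_le (by positivity) fun m hm => ?_
    obtain ⟨hm1, -, -, -, -, -, h, -⟩ := exists_of_mem_activeSet hθ hg hc hcmp hm
    exact ⟨hm1, by rw [le_div_iff₀ hc]; linarith⟩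
  have h3 : (Real.log x / c) ^ (1 + β) = Real.log x ^ 2 * ((1 / c) ^ (1 + β)
      * Real.log x ^ (-(1 - β))) := by
    rw [div_eq_mul_one_div, Real.mul_rpow hlx.le (by positivity),
      show 1 + β = 2 + -(1 - β) by ring, Real.rpow_add hlx, Real.rpow_two]
    ring
  rw [Finset.mul_sum, ← Finset.sum_sub_distrib]
  calc _ ≤ ∑ m ∈ activeSet θ x, M₁ * C * (x / Real.log x ^ 2) * (g m / m) :=
        (Finset.abs_sum_le_sum_abs _ _).trans (Finset.sum_le_sum h1)
    _ ≤ M₁ * C * (x / Real.log x ^ 2) * (K * (Real.log x / c) ^ (1 + β)) := by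
        rw [← Finset.mul_sum]
        exact mul_le_mul_of_nonneg_left h2 (by positivity)
    _ = _ := by rw [h3]; field_simp

/-- The part of the series `L` outside the active `m`: there `g(m) ≫ log x`. -/
lemma exists_sieveL_sub_le (hθ : Admissible θ) (hg : RegularGrowth g β K) (hc : 0 < c)
    (hC : 0 < C) (hcmp : Comparable θ g c C) :
    ∃ M : ℝ, 0 < M ∧ ∀ x : ℝ, 2 ≤ x →
      |sieveL θ - ∑ m ∈ activeSet θ x, sieveTerm θ m| ≤ M * Real.log x ^ (-(1 - β)) := by
  classical
  have hK := hg.const_pos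
  refine ⟨1 / c * (K * (1 / (K + C)) ^ (-(1 - β))), by positivity, fun x hx => ?_⟩
  have hx0 : 0 < x := by linarith
  have hlx : 0 < Real.log x := Real.log_pos (by linarith)
  have hs := summable_sieveTerm hθ hg hc hcmp
  have hL : sieveL θ = ∑' n, sieveTerm θ n := rfl
  have h1 := hs.sum_le_tsum (activeSet θ x) fun n _ => sieveTerm_nonneg θ n
  rw [← hL] at h1
  rw [abs_of_nonneg (by linarith), sub_le_iff_le_add, hL]
  refine hs.tsum_le_of_sum_le fun s => ?_
  rw [← Finset.sum_filter_add_sum_filter_not s (fun m => m ∉ activeSet θ x ∧ sieveTerm θ m ≠ 0)]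
  refine add_le_add ?_ ?_
  · -- nonzero terms outside the active set have `m θ(m) ≥ x`, so `log x ≤ (K + C) g(m)`
    have h2 : ∀ m ∈ s.filter (fun m => m ∉ activeSet θ x ∧ sieveTerm θ m ≠ 0),
        1 ≤ m ∧ Real.log x * (1 / (K + C)) ≤ g m := by
      intro m hm
      obtain ⟨-, hna, hne⟩ := Finset.mem_filter.1 hm
      have hB : m ∈ sieveSet θ := by
        by_contra hB
        exact hne (sieveTerm_of_notMem hB)
      have hm1 : 1 ≤ m := hB.1
      have hm0 : (1 : ℝ) ≤ m := by exact_mod_cast hm1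
      have hfin : θ m ≠ ⊤ := fun h => hne (by
        rw [sieveTerm_of_mem hB, h, eulerProduct_top, mul_zero])
      obtain ⟨t, ht⟩ := WithTop.ne_top_iff_exists.1 hfin
      replace ht := ht.symm
      have ht2 := hθ.two_le_of_eq hm1 ht
      have hle : x ≤ m * t := by
        rcases le_or_gt (m : ℝ) x with hmx | hmx
        · by_contra hcon
          refine hna (mem_activeSet.2 ⟨hB, hmx, ?_⟩)
          rw [ht, WithTop.coe_lt_coe, lt_div_iff₀ (by linarith)]
          linarith
        · exact hmx.le.trans (le_mul_of_one_le_right (by linarith) (by linarith))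
      have h3 := Real.log_le_log hx0 hle
      rw [Real.log_mul (by linarith) (by linarith)] at h3
      have h4 := (hcmp m hm1 t ht).2
      have h5 := hg.log_le m hm1
      refine ⟨hm1, ?_⟩
      rw [mul_one_div, div_le_iff₀ (by positivity)]
      linarith
    calc _ ≤ ∑ m ∈ s with m ∉ activeSet θ x ∧ sieveTerm θ m ≠ 0,
          1 / c * (1 / ((m : ℝ) * g m)) :=
          Finset.sum_le_sum fun m hm => sieveTerm_le hθ hg hc hcmp (h2 m hm).1
      _ ≤ 1 / c * (K * (Real.log x * (1 / (K + C))) ^ (-(1 - β))) := by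
          rw [← Finset.mul_sum]
          exact mul_le_mul_of_nonneg_left (hg.tail_le_of_le (by positivity) h2) (by positivity)
      _ = _ := by
          rw [Real.mul_rpow hlx.le (by positivity)]
          ring
  · rw [← Finset.sum_filter_ne_zero]
    refine Finset.sum_le_sum_of_subset_of_nonneg (fun m hm => ?_) fun m _ _ => sieveTerm_nonneg θ m
    simp only [Finset.mem_filter] at hm
    by_contra hcon
    exact hm.1.2 ⟨hcon, hm.2⟩

lemma rpow_log_le_self {x r : ℝ} (hx : 2 ≤ x) (hr0 : 0 ≤ r) (hr1 : r ≤ 1) :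
    Real.log x ^ r ≤ x := by
  have hlx : 0 < Real.log x := Real.log_pos (by linarith)
  have h1 := Real.log_le_sub_one_of_pos (show 0 < x by linarith)
  rcases le_or_gt (Real.log x) 1 with h | h
  · exact (Real.rpow_le_one hlx.le h hr0).trans (by linarith)
  · calc Real.log x ^ r ≤ Real.log x ^ (1 : ℝ) := Real.rpow_le_rpow_of_exponent_le h.le hr1
      _ ≤ x := by rw [Real.rpow_one]; linarith

lemma exists_abs_countB_sub_le (hθ : Admissible θ) (hg : RegularGrowth g β K) (hc : 0 < c)
    (hC : 0 < C) (hcmp : Comparable θ g c C) :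
    ∃ M : ℝ, 0 < M ∧ ∀ x : ℝ, 2 ≤ x →
      |(countB θ x : ℝ) - (1 - sieveL θ) * x| ≤ M * (x * Real.log x ^ (-(1 - β))) := by
  obtain ⟨M₁, hM₁, h₁⟩ := exists_sum_activeSet_le hθ hg hc hC hcmp
  obtain ⟨M₂, hM₂, h₂⟩ := exists_sieveL_sub_le hθ hg hc hC hcmp
  refine ⟨1 + M₁ + M₂, by positivity, fun x hx => ?_⟩
  have hx0 : 0 < x := by linarith
  have hlx : 0 < Real.log x := Real.log_pos (by linarith)
  have h1 := h₁ x hx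
  have h2 := mul_le_mul_of_nonneg_left (h₂ x hx) hx0.le
  rw [← abs_of_pos hx0, ← abs_mul, abs_of_pos hx0] at h2
  have h3 : |(⌊x⌋₊ : ℝ) - x| ≤ 1 := by
    rw [abs_le]
    constructor <;> linarith [Nat.floor_le hx0.le, Nat.lt_floor_add_one x]
  have h4 : 1 ≤ x * Real.log x ^ (-(1 - β)) := by
    rw [Real.rpow_neg hlx.le, ← div_eq_mul_inv, one_le_div (by positivity)]
    exact rpow_log_le_self hx (by linarith [hg.beta_lt_one]) (by linarith [hg.beta_nonneg])
  rw [countB_eq_sub hθ x]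
  rw [abs_le] at h1 h2 h3 ⊢
  constructor <;> nlinarith

/-- `L < 1`: otherwise `B(x) = o(x)`. -/
lemma sieveL_lt_one (hθ : Admissible θ) (hg : RegularGrowth g β K) (hc : 0 < c)
    (hC : 0 < C) (hcmp : Comparable θ g c C) : sieveL θ < 1 := by
  obtain ⟨M, hM, h⟩ := exists_abs_countB_sub_le hθ hg hc hC hcmp
  obtain ⟨δ, hδ, hδb⟩ := exists_le_countB hθ hg hc hcmp
  have hβ := hg.beta_lt_one
  have hlim : Filter.Tendsto (fun x : ℝ => M * Real.log x ^ (-(1 - β)) + 2 / x) Filter.atTop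
      (nhds (M * 0 + 0)) := by
    refine Filter.Tendsto.add (Filter.Tendsto.const_mul M ?_) ?_
    · exact (tendsto_rpow_neg_atTop (show 0 < 1 - β by linarith)).comp Real.tendsto_log_atTop
    · exact Filter.Tendsto.div_atTop tendsto_const_nhds Filter.tendsto_id
  rw [mul_zero, add_zero] at hlim
  obtain ⟨x, hx, hx2⟩ := ((hlim.eventually_lt_const hδ).and (Filter.eventually_ge_atTop 2)).exists
  have hx0 : 0 < x := by linarith
  have h1 := (abs_le.1 (h x hx2)).2
  have h2 := hδb x hx0.le
  by_contra! hL
  have h3 : (1 - sieveL θ) * x ≤ 0 := mul_nonpos_of_nonpos_of_nonneg (by linarith) hx0.le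
  have h4 := mul_lt_mul_of_pos_right hx hx0
  rw [add_mul, div_mul_cancel₀ _ hx0.ne'] at h4
  nlinarith

/-- The asymptotic formula for regularly growing `log θ`. -/
lemma asymptotic_of_regularGrowth (hθ : Admissible θ) (hg : RegularGrowth g β K) (hc : 0 < c)
    (hC : 0 < C) (hcmp : Comparable θ g c C) (hfin : ∀ᶠ n in Filter.atTop, θ n ≠ ⊤) :
    0 < sieveL θ ∧ sieveL θ < 1 ∧ ∃ K : ℝ, ∀ x : ℝ, 2 ≤ x → ∃ ε : ℝ,
      |ε| ≤ K * (1 / Real.log x ^ (1 - β)) ∧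
        (countB θ x : ℝ) = (1 - sieveL θ) * x * (1 + ε) := by
  have hL := sieveL_lt_one hθ hg hc hC hcmp
  refine ⟨sieveL_pos hθ (summable_sieveTerm hθ hg hc hcmp) hfin, hL, ?_⟩
  obtain ⟨M, hM, h⟩ := exists_abs_countB_sub_le hθ hg hc hC hcmp
  have hL' : 0 < 1 - sieveL θ := by linarith
  refine ⟨M / (1 - sieveL θ), fun x hx => ?_⟩
  have hx0 : 0 < x := by linarith
  have hlx : 0 < Real.log x := Real.log_pos (by linarith)
  have hLx : 0 < (1 - sieveL θ) * x := by positivity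
  refine ⟨((countB θ x : ℝ) - (1 - sieveL θ) * x) / ((1 - sieveL θ) * x), ?_, ?_⟩
  · rw [abs_div, abs_of_pos hLx, div_le_iff₀ hLx]
    refine (h x hx).trans (le_of_eq ?_)
    rw [Real.rpow_neg hlx.le]
    field_simp
  · field_simp
    ring

/-! ### The two classes of growth -/

lemma sum_Icc_le_of_telescope {f T : ℕ → ℝ} {D : ℝ} (hD : 0 ≤ D) {N : ℕ}
    (hT : ∀ m, N ≤ m → 0 ≤ T m) (h : ∀ m, N ≤ m → f m ≤ D * (T m - T (m + 1))) (M : ℕ) :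
    ∑ m ∈ Finset.Icc N M, f m ≤ D * T N := by
  rcases lt_or_ge M N with hMN | hMN
  · rw [Finset.Icc_eq_empty (by omega), Finset.sum_empty]
    exact mul_nonneg hD (hT N le_rfl)
  have key : ∑ m ∈ Finset.Icc N M, f m ≤ D * (T N - T (M + 1)) := by
    induction M, hMN using Nat.le_induction with
    | base => simpa using h N le_rfl
    | succ M hM ih =>
      rw [Finset.sum_Icc_succ_top (by omega)]
      have := h (M + 1) (by omega)
      linarith
  have := mul_nonneg hD (hT (M + 1) (by omega))
  linarith

/-- A sum bounded by telescoping `G^{-σ}`, where `G` at most doubles from `m` to `m + 1`. -/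
lemma sum_tail_le_rpow_neg {f G : ℕ → ℝ} {σ : ℝ} (hσ : 0 < σ) {N : ℕ}
    (hG : ∀ m, N ≤ m → 0 < G m) (hG2 : ∀ m, N ≤ m → G (m + 1) ≤ 2 * G m)
    (h : ∀ m, N ≤ m → f m ≤ 2 * (G m ^ (-(1 + σ)) * (G (m + 1) - G m)))
    (hmono : ∀ m, N ≤ m → G m ≤ G (m + 1)) (M : ℕ) :
    ∑ m ∈ Finset.Icc N M, f m ≤ 2 * 2 ^ (1 + σ) / σ * G N ^ (-σ) := by
  refine sum_Icc_le_of_telescope (T := fun m => G m ^ (-σ)) (by positivity)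
    (fun m hm => Real.rpow_nonneg (hG m hm).le _) (fun m hm => ?_) M
  have h0 := hG m hm
  have h1 := hG (m + 1) (by omega)
  have h2 := mul_sub_le_rpow_neg_sub hσ h0 h1
  have h3 : G m ^ (-(1 + σ)) ≤ 2 ^ (1 + σ) * G (m + 1) ^ (-(1 + σ)) := by
    have h4 : (2 * G m) ^ (-(1 + σ)) ≤ G (m + 1) ^ (-(1 + σ)) :=
      Real.rpow_le_rpow_of_nonpos h1 (hG2 m hm) (by linarith)
    rw [Real.mul_rpow two_pos.le h0.le, Real.rpow_neg two_pos.le,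
      inv_mul_le_iff₀ (by positivity)] at h4
    exact h4
  have h5 := mul_le_mul_of_nonneg_right h3 (sub_nonneg.2 (hmono m hm))
  calc f m ≤ 2 * (G m ^ (-(1 + σ)) * (G (m + 1) - G m)) := h m hm
    _ ≤ 2 * (2 ^ (1 + σ) * G (m + 1) ^ (-(1 + σ)) * (G (m + 1) - G m)) := by gcongr
    _ = 2 * 2 ^ (1 + σ) / σ * (σ * (G (m + 1) ^ (-(1 + σ)) * (G (m + 1) - G m))) := by
        field_simp
    _ ≤ _ := mul_le_mul_of_nonneg_left h2 (by positivity)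

lemma sum_rpow_div_le {a : ℝ} (ha : 0 < a) {N : ℕ} (hN : 1 ≤ N) :
    ∑ m ∈ Finset.Icc 1 N, (m : ℝ) ^ a / m ≤ (1 / a + 1) * (N : ℝ) ^ a := by
  -- for `a ≤ 1` the sum telescopes by Bernoulli's inequality; for `a > 1` each term is at most
  -- `N^{a-1}`
  rcases le_or_gt a 1 with h1 | h1
  · have key : ∑ m ∈ Finset.Icc 1 N, (m : ℝ) ^ a / m ≤ 1 / a * (N : ℝ) ^ a := by
      induction N, hN using Nat.le_induction with
      | base => simpa using (one_le_inv₀ ha).2 h1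
      | succ N hN ih =>
        rw [Finset.sum_Icc_succ_top (by omega)]
        refine (add_le_add_left ih _).trans ?_
        have hN0 : (0 : ℝ) < N := by exact_mod_cast hN
        have hB : (0 : ℝ) < ((N + 1 : ℕ) : ℝ) := by positivity
        have h2 := rpow_one_add_le_one_add_mul_self
          (s := -(1 / ((N + 1 : ℕ) : ℝ))) (by
            rw [neg_le_neg_iff, div_le_one hB]; push_cast; linarith) ha.le h1
        have h3 : 1 + -(1 / ((N + 1 : ℕ) : ℝ)) = N / ((N + 1 : ℕ) : ℝ) := by
          push_cast; field_simp; ring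
        rw [h3, Real.div_rpow hN0.le hB.le, div_le_iff₀ (by positivity)] at h2
        have h4 : (1 + a * -(1 / ((N + 1 : ℕ) : ℝ))) * ((N + 1 : ℕ) : ℝ) ^ a
            = ((N + 1 : ℕ) : ℝ) ^ a - a * (((N + 1 : ℕ) : ℝ) ^ a / ((N + 1 : ℕ) : ℝ)) := by ring
        rw [h4] at h2
        rw [one_div_mul_eq_div, one_div_mul_eq_div, div_add' _ _ _ ha.ne']
        refine div_le_div_of_nonneg_right ?_ ha.le
        linarith
    have : 0 ≤ (N : ℝ) ^ a := by positivity
    linarith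
  · calc ∑ m ∈ Finset.Icc 1 N, (m : ℝ) ^ a / m ≤ ∑ m ∈ Finset.Icc 1 N, (N : ℝ) ^ (a - 1) := by
          refine Finset.sum_le_sum fun m hm => ?_
          rw [Finset.mem_Icc] at hm
          have hm0 : (0 : ℝ) < m := by exact_mod_cast hm.1
          rw [← Real.rpow_sub_one hm0.ne']
          exact Real.rpow_le_rpow hm0.le (by exact_mod_cast hm.2) (by linarith)
      _ = (N : ℝ) ^ a := by
          have hN0 : (N : ℝ) ≠ 0 := by positivity
          rw [Finset.sum_const, Nat.card_Icc, Nat.add_sub_cancel, nsmul_eq_mul,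
            Real.rpow_sub_one hN0]
          field_simp
      _ ≤ _ := by
          have h2 : 0 ≤ (N : ℝ) ^ a := by positivity
          have h3 : 0 ≤ 1 / a := by positivity
          nlinarith

lemma regularGrowth_rpow {a : ℝ} (ha : 0 < a) :
    ∃ K : ℝ, RegularGrowth (fun n => (n : ℝ) ^ a) 0 K := by
  have hD : 0 < 2 * 2 ^ (1 + a) / a := by positivity
  have ha' : 0 < 1 / a := by positivity
  refine ⟨1 / a + 1 + 2 * 2 ^ (1 + a) / a, le_rfl, one_pos, by positivity, fun m hm => ?_,
    fun m n _ hmn => ?_, fun m hm => ?_, fun N hN => ?_, fun N hN M => ?_⟩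
  · have : (0 : ℝ) < m := by exact_mod_cast hm
    positivity
  · exact Real.rpow_le_rpow (Nat.cast_nonneg m) (by exact_mod_cast hmn) ha.le
  · refine (Real.log_le_rpow_div (Nat.cast_nonneg m) ha).trans ?_
    rw [div_eq_mul_one_div, mul_comm]
    exact mul_le_mul_of_nonneg_right (by linarith) (by positivity)
  · rw [add_zero, Real.rpow_one]
    exact (sum_rpow_div_le ha hN).trans (mul_le_mul_of_nonneg_right (by linarith) (by positivity))
  · have hpos : ∀ m : ℕ, N ≤ m → (0 : ℝ) < m := fun m hm => by exact_mod_cast hN.trans hm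
    have h1 := sum_tail_le_rpow_neg (f := fun m : ℕ => 1 / ((m : ℝ) * (m : ℝ) ^ a))
      (G := fun m => (m : ℝ)) ha hpos (fun m hm => ?_) (fun m hm => ?_) (fun m _ => ?_) M
    · refine h1.trans ?_
      rw [sub_zero, Real.rpow_neg_one, ← Real.rpow_neg (Nat.cast_nonneg N)]
      exact mul_le_mul_of_nonneg_right (by linarith) (by positivity)
    · have : (1 : ℝ) ≤ m := by exact_mod_cast hN.trans hm
      push_cast
      linarith
    · have h0 := hpos m hm
      rw [show ((m + 1 : ℕ) : ℝ) - m = 1 by push_cast; ring, mul_one, Real.rpow_neg h0.le,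
        Real.rpow_add h0, Real.rpow_one, one_div]
      exact le_mul_of_one_le_left (by positivity) one_le_two
    · exact_mod_cast Nat.le_succ m

lemma regularGrowth_log_rpow {a : ℝ} (ha : 1 < a) :
    ∃ K : ℝ, RegularGrowth (fun n => Real.log (2 * (n : ℝ)) ^ a) (1 / a) K := by
  have ha0 : 0 < a := by linarith
  have hl2 : 0 < Real.log 2 := Real.log_pos one_lt_two
  have hlog : ∀ m : ℕ, 1 ≤ m → Real.log 2 ≤ Real.log (2 * (m : ℝ)) := fun m hm =>
    Real.log_le_log two_pos (by
      have : (1 : ℝ) ≤ m := by exact_mod_cast hm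
      linarith)
  have hlogmono : ∀ m n : ℕ, 1 ≤ m → m ≤ n →
      Real.log (2 * (m : ℝ)) ≤ Real.log (2 * (n : ℝ)) := fun m n hm hmn => by
    have h1 : (1 : ℝ) ≤ m := by exact_mod_cast hm
    have h2 : (m : ℝ) ≤ n := by exact_mod_cast hmn
    exact Real.log_le_log (by linarith) (by linarith)
  set D := 2 * (2 : ℝ) ^ (1 + (a - 1)) / (a - 1) with hDdef
  have hD : 0 < D := div_pos (by positivity) (by linarith)
  have hE : 0 < Real.log 2 ^ (1 - a) := by positivity
  have hF : 0 < 1 / Real.log 2 := by positivity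
  refine ⟨1 / Real.log 2 + Real.log 2 ^ (1 - a) + D, by positivity, (div_lt_one ha0).2 ha,
    by positivity, fun m hm => ?_, fun m n hm hmn => ?_, fun m hm => ?_, fun N hN => ?_,
    fun N hN M => ?_⟩
  · have := hl2.trans_le (hlog m hm)
    positivity
  · exact Real.rpow_le_rpow (hl2.trans_le (hlog m hm)).le (hlogmono m n hm hmn) ha0.le
  · have h1 := hl2.trans_le (hlog m hm)
    have hm0 : (1 : ℝ) ≤ m := by exact_mod_cast hm
    calc Real.log m ≤ Real.log (2 * m) := Real.log_le_log (by linarith) (by linarith)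
      _ = Real.log (2 * m) ^ (1 - a) * Real.log (2 * m) ^ a := by
          rw [← Real.rpow_add h1, sub_add_cancel, Real.rpow_one]
      _ ≤ Real.log 2 ^ (1 - a) * Real.log (2 * m) ^ a := mul_le_mul_of_nonneg_right
          (Real.rpow_le_rpow_of_nonpos hl2 (hlog m hm) (by linarith)) (by positivity)
      _ ≤ _ := mul_le_mul_of_nonneg_right (by linarith) (by positivity)
  · have h1 := hl2.trans_le (hlog N hN)
    have hN0 : (1 : ℝ) ≤ N := by exact_mod_cast hN
    have hharm : ∑ m ∈ Finset.Icc 1 N, 1 / (m : ℝ) ≤ 1 + Real.log N := by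
      have h2 := harmonic_le_one_add_log N
      rw [harmonic_eq_sum_Icc] at h2
      push_cast at h2
      simpa [one_div] using h2
    have h3 : 1 + Real.log N ≤ 1 / Real.log 2 * Real.log (2 * N) := by
      rw [Real.log_mul two_ne_zero (by linarith), one_div_mul_eq_div, add_div, div_self hl2.ne']
      have h4 : Real.log N ≤ Real.log N / Real.log 2 := by
        rw [le_div_iff₀ hl2]
        exact mul_le_of_le_one_right (Real.log_nonneg hN0) (by linarith [Real.log_two_lt_d9])
      linarith
    have h5 : (Real.log (2 * (N : ℝ)) ^ a) ^ (1 + 1 / a)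
        = Real.log (2 * (N : ℝ)) ^ a * Real.log (2 * N) := by
      rw [← Real.rpow_mul h1.le, mul_add, mul_one, mul_one_div_cancel ha0.ne', Real.rpow_add h1,
        Real.rpow_one]
    rw [h5]
    calc ∑ m ∈ Finset.Icc 1 N, Real.log (2 * (m : ℝ)) ^ a / m
        ≤ ∑ m ∈ Finset.Icc 1 N, Real.log (2 * (N : ℝ)) ^ a * (1 / (m : ℝ)) := by
          refine Finset.sum_le_sum fun m hm => ?_
          rw [Finset.mem_Icc] at hm
          rw [mul_one_div]
          exact div_le_div_of_nonneg_right (Real.rpow_le_rpow (hl2.trans_le (hlog m hm.1)).le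
            (hlogmono m N hm.1 hm.2) ha0.le) (Nat.cast_nonneg m)
      _ ≤ Real.log (2 * (N : ℝ)) ^ a * (1 / Real.log 2 * Real.log (2 * N)) := by
          rw [← Finset.mul_sum]
          exact mul_le_mul_of_nonneg_left (hharm.trans h3) (by positivity)
      _ = 1 / Real.log 2 * (Real.log (2 * (N : ℝ)) ^ a * Real.log (2 * N)) := by ring
      _ ≤ _ := mul_le_mul_of_nonneg_right (by linarith) (by positivity)
  · have hpos : ∀ m : ℕ, N ≤ m → 0 < Real.log (2 * (m : ℝ)) := fun m hm =>
      hl2.trans_le (hlog m (hN.trans hm))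
    have h1 := sum_tail_le_rpow_neg
      (f := fun m : ℕ => 1 / ((m : ℝ) * Real.log (2 * (m : ℝ)) ^ a))
      (G := fun m => Real.log (2 * (m : ℝ))) (σ := a - 1) (by linarith) hpos (fun m hm => ?_)
      (fun m hm => ?_) (fun m hm => hlogmono m (m + 1) (hN.trans hm) (Nat.le_succ m)) M
    · refine h1.trans ?_
      have h2 : (Real.log (2 * (N : ℝ)) ^ a) ^ (-(1 - 1 / a)) = Real.log (2 * N) ^ (-(a - 1)) := by
        rw [← Real.rpow_mul (hpos N le_rfl).le]
        congr 1
        field_simp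
      rw [h2]
      exact mul_le_mul_of_nonneg_right (by linarith) (Real.rpow_nonneg (hpos N le_rfl).le _)
    · have hm0 : (1 : ℝ) ≤ m := by exact_mod_cast hN.trans hm
      calc Real.log (2 * ((m + 1 : ℕ) : ℝ)) ≤ Real.log ((2 * m) ^ 2) := by
            refine Real.log_le_log (by positivity) ?_
            push_cast
            nlinarith
        _ = 2 * Real.log (2 * m) := by rw [Real.log_pow]; norm_num
    · have hm0 : (1 : ℝ) ≤ m := by exact_mod_cast hN.trans hm
      have h0 := hpos m hm
      have h2 : Real.log (2 * ((m + 1 : ℕ) : ℝ)) - Real.log (2 * (m : ℝ))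
          = Real.log (((m + 1 : ℕ) : ℝ) / m) := by
        rw [← Real.log_div (by positivity) (by positivity), mul_div_mul_left _ _ two_ne_zero]
      have h3 := Real.one_sub_inv_le_log_of_pos
        (show (0 : ℝ) < ((m + 1 : ℕ) : ℝ) / m by positivity)
      have h4 : 1 / (2 * (m : ℝ)) ≤ 1 - (((m + 1 : ℕ) : ℝ) / m)⁻¹ := by
        rw [inv_div, one_sub_div (by positivity), div_le_div_iff₀ (by positivity) (by positivity)]
        push_cast
        linarith
      rw [h2, show -(1 + (a - 1)) = -a by ring, Real.rpow_neg h0.le]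
      calc 1 / ((m : ℝ) * Real.log (2 * (m : ℝ)) ^ a)
          = 2 * ((Real.log (2 * (m : ℝ)) ^ a)⁻¹ * (1 / (2 * (m : ℝ)))) := by field_simp
        _ ≤ _ := by
          have := h4.trans h3
          gcongr

/-! ### Comparison of `log θ` with its order of growth -/

/-- The asymptotic bounds extend to all `m ≥ 1` after a change of constants, as
`log 2 ≤ log θ(m)` and only finitely many `m` are affected. -/
lemma exists_comparable {θ : ℕ → WithTop ℝ} {g : ℕ → ℝ} {β K : ℝ} (hθ : Admissible θ)
    (hg : RegularGrowth g β K) (h : Asymp (fun n => extLog (θ n)) g) :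
    ∃ c C : ℝ, 0 < c ∧ 0 < C ∧ Comparable θ g c C := by
  obtain ⟨c, C, hc, hC, hev⟩ := h
  obtain ⟨N, hN⟩ := Filter.eventually_atTop.1 hev
  have hl2 : 0 < Real.log 2 := Real.log_pos one_lt_two
  have hgN := hg.pos (N + 1) (by omega)
  set f : ℕ → ℝ := fun m => |Real.log ((θ m).untopD 0)| / g m with hf
  have hf0 : ∀ m ∈ Finset.Icc 1 N, 0 ≤ f m := fun m hm =>
    div_nonneg (abs_nonneg _) (hg.pos m (Finset.mem_Icc.1 hm).1).le
  refine ⟨min c (Real.log 2 / g (N + 1)), C + ∑ m ∈ Finset.Icc 1 N, f m,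
    lt_min hc (by positivity), add_pos_of_pos_of_nonneg hC (Finset.sum_nonneg hf0),
    fun m hm t ht => ?_⟩
  have hgm := hg.pos m hm
  rcases le_or_gt N m with hNm | hNm
  · have h1 := hN m hNm
    simp only [ht, extLog, WithTop.map_coe, WithTop.coe_le_coe] at h1
    refine ⟨(mul_le_mul_of_nonneg_right (min_le_left _ _) hgm.le).trans h1.1, h1.2.trans ?_⟩
    exact mul_le_mul_of_nonneg_right (le_add_of_nonneg_right (Finset.sum_nonneg hf0)) hgm.le
  · have ht2 := hθ.two_le_of_eq hm ht
    constructor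
    · calc min c (Real.log 2 / g (N + 1)) * g m ≤ Real.log 2 / g (N + 1) * g (N + 1) :=
            mul_le_mul (min_le_right _ _) (hg.mono m (N + 1) hm (by omega)) hgm.le (by positivity)
        _ = Real.log 2 := div_mul_cancel₀ _ hgN.ne'
        _ ≤ Real.log t := Real.log_le_log two_pos ht2
    · have h1 := Finset.single_le_sum hf0 (Finset.mem_Icc.2 ⟨hm, hNm.le⟩)
      have h2 : f m * g m = |Real.log t| := by
        simp only [hf, ht, WithTop.untopD_coe]
        exact div_mul_cancel₀ _ hgm.ne'
      calc Real.log t ≤ f m * g m := h2 ▸ le_abs_self _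
        _ ≤ _ := mul_le_mul_of_nonneg_right (by linarith) hgm.le

lemma eventually_ne_top_of_asymp {θ : ℕ → WithTop ℝ} {g : ℕ → ℝ}
    (h : Asymp (fun n => extLog (θ n)) g) : ∀ᶠ n in Filter.atTop, θ n ≠ ⊤ := by
  obtain ⟨c, C, -, -, hev⟩ := h
  filter_upwards [hev] with n hn htop
  have h1 := hn.2
  rw [htop, extLog, WithTop.map_top, top_le_iff] at h1
  exact WithTop.coe_ne_top h1

end SieveProblem

theorem mainTheorem3 (θ : ℕ → WithTop ℝ) (hθ : SieveProblem.Admissible θ) :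
    (∀ a : ℝ, 0 < a →
      SieveProblem.Asymp (fun n => SieveProblem.extLog (θ n)) (fun n => (n : ℝ) ^ a) →
      0 < SieveProblem.sieveL θ ∧ SieveProblem.sieveL θ < 1 ∧
        ∃ K : ℝ, ∀ x : ℝ, 2 ≤ x → ∃ ε : ℝ, |ε| ≤ K * (1 / Real.log x) ∧
          (SieveProblem.countB θ x : ℝ) = (1 - SieveProblem.sieveL θ) * x * (1 + ε)) ∧
    (∀ a : ℝ, 1 < a →
      SieveProblem.Asymp (fun n => SieveProblem.extLog (θ n))
        (fun n => (Real.log (2 * (n : ℝ))) ^ a) →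
      0 < SieveProblem.sieveL θ ∧ SieveProblem.sieveL θ < 1 ∧
        ∃ K : ℝ, ∀ x : ℝ, 2 ≤ x → ∃ ε : ℝ, |ε| ≤ K * (1 / (Real.log x) ^ (1 - 1 / a)) ∧
          (SieveProblem.countB θ x : ℝ) = (1 - SieveProblem.sieveL θ) * x * (1 + ε)) := by
  refine ⟨fun a ha h => ?_, fun a ha h => ?_⟩
  · obtain ⟨K, hg⟩ := SieveProblem.regularGrowth_rpow ha
    obtain ⟨c, C, hc, hC, hcmp⟩ := SieveProblem.exists_comparable hθ hg h
    simpa only [sub_zero, Real.rpow_one] using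
      SieveProblem.asymptotic_of_regularGrowth hθ hg hc hC hcmp
        (SieveProblem.eventually_ne_top_of_asymp h)
  · obtain ⟨K, hg⟩ := SieveProblem.regularGrowth_log_rpow ha
    obtain ⟨c, C, hc, hC, hcmp⟩ := SieveProblem.exists_comparable hθ hg h
    exact SieveProblem.asymptotic_of_regularGrowth hθ hg hc hC hcmp
      (SieveProblem.eventually_ne_top_of_asymp h)
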